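/- Let $n\in\mathbb N$, let $\Omega\subset\mathbb R^n$ be open with unbounded boundary $\Gamma=\partial\Omega$, let $\delta(X)=\operatorname{dist}(X,\Gamma)$, let $\mu$ be a locally finite Borel measure carried by $\Gamma$ and $m$ a measure on $\Omega$. Put $\rho(x,r)=\dfrac{m(B(x,r)\cap\Omega)}{r\,\mu(B(x,r))}$ for $x\in\Gamma$, $r>0$. Assume that there are constants $C_1,\dots,C_6$ such that: (H1) for all $x\in\Gamma$, $r>0$ there is $X\in B(x,r)$ with $B(X,r/C_1)\subset\Omega$ (with $C_1>0$); (H2) $C_2=N+1$ with $N\in\mathbb N$, and if $r>0$, $X,Y\in\Omega$, $\delta(X)>r$, $\delta(Y)>r$ and $|X-Y|\le 7C_1r$, there are points $Z_0=X,\dots,Z_N=Y$ of $\Omega$ with $|Z_i-Z_{i+1}|<\frac12\delta(Z_i)$ for $0\le i<N$; (H3) $\operatorname{supp}\mu=\Gamma$, $C_3>1$, and $\mu(B(x,2r))\le C_3\,\mu(B(x,r))$ for $x\in\Gamma$, $r>0$; (H4) $dm=w\,dX$ on $\Omega$ with $w\in L^1_{loc}(\Omega)$ and $w>0$ a.e.,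 $C_4\ge1$, and $m(B(X,2r)\cap\Omega)\le C_4\,m(B(X,r)\cap\Omega)$ for $X\in\overline\Omega$, $r>0$; (H5) $\rho(x,r)/\rho(x,s)\le C_5\,(r/s)^{1-1/C_5}$ for $x\in\Gamma$, $0<s<r$ (with $C_5>0$); (H6) if $D\Subset\Omega$ is open, $u_i\in C^\infty(\overline D)$, $v\in L^2(D,m)$, $\int_D|u_i|\,dm\to0$ and $\int_D|\nabla u_i-v|^2dm\to0$, then $v=0$ $m$-a.e. on $D$; and ⨍$_B|u-u_B|\,dm\le C_6\,r\,\big($⨍$_B|\nabla u|^2dm\big)^{1/2}$ for each ball $B$ of radius $r$ with $2B\subset\Omega$ and each $u\in C^\infty(\overline B)$, where $u_B=$ ⨍$_B u\,dm$ and ⨍ denotes an average. Here, for a closed set $F$, $C^\infty(F)$ is the set of restrictions to $F$ of functions of $C^\infty(\mathbb R^n)$. *Spaces.* $W$ is the set of $u\in L^1_{loc}(\Omega,m)$ for which there are $v\in L^2(\Omega,m)$ and $\varphi_i\in C^\infty(\overline\Omega)$ with $\int_\Omega|\nabla\varphi_i|^2dm<\infty$, $\int_B|\varphi_i-u|\,dm\to0$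 for every ball $B$ with $2B\subset\Omega$, and $\int_\Omega|\nabla\varphi_i-v|^2dm\to0$; by (H6) this $v$ is unique, and it is written $\nabla u$. $H$ is the set of $\mu$-measurable $g:\Gamma\to\mathbb R$ with $$\|g\|_H^2:=\int_\Gamma\int_\Gamma\frac{\rho(x,|x-y|)^2\,|g(x)-g(y)|^2}{m(B(x,|x-y|)\cap\Omega)}\,d\mu(y)\,d\mu(x)<\infty .$$ *Extension.* Let $\mathcal W$ be the Whitney decomposition of $\Omega$: the closed dyadic cubes $I\subset\Omega$ with $4\operatorname{diam}I\le\operatorname{dist}(4I,\Gamma)$ whose dyadic parent does not satisfy this inequality ($\lambda I$ being the cube with the same center as $I$ and $\lambda$ times its side length $\ell(I)$). Let $\{\varphi_I\}_{I\in\mathcal W}$ be smooth functions supported in $2I$ with $0\le\varphi_I\le1$, $|\nabla\varphi_I|\le K/\ell(I)$ and $\sum_I\varphi_I=\mathbf 1_\Omega$. Let $\xi_I\in\Gamma$ satisfy $\operatorname{dist}(\xi_I,I)\le2\operatorname{dist}(I,\Gamma)$, set $B_I=B(\xi_I,\ell(I))$, and $$\operatorname{Ext}g(X)=\sum_{I\in\mathcal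 W}\varphi_I(X)\ \frac1{\mu(B_I)}\int_{B_I}g\,d\mu .$$ *Trace.* Let $\{\mathbb D_k\}_{k\in\mathbb Z}$ be a system of dyadic pseudocubes on $\Gamma$: each $\mathbb D_k$ is a family of measurable sets with union $\Gamma$; if $k\le l$, $Q\in\mathbb D_l$ and $Q'\in\mathbb D_k$, then $Q\subset Q'$ or $Q\cap Q'=\emptyset$; if $l<k$, each $Q\in\mathbb D_k$ lies in a unique $Q'\in\mathbb D_l$; $\operatorname{diam}Q\le2^{-k}$ for $Q\in\mathbb D_k$; and for some $a_0>0$ each $Q\in\mathbb D_k$ contains $B(z,a_02^{-k})\cap\Gamma$ for some $z\in\Gamma$. Let $C_a\ge1000\,C_1\sqrt n$. For $Q\in\mathbb D_k$ let $U_Q$ be the union of the $I\in\mathcal W$ with $\ell(I)\ge C_a^{-1}2^{-k}$ and $\operatorname{dist}(I,Q)\le2\cdot2^{-k}$; let $\gamma(x)$ be the union of the $U_Q$ over all $k$ and all $Q\in\mathbb D_k$ containing $x$; and let $$\operatorname{Tr}u(x)=\lim_{X\in\gamma(x),\ \delta(X)\to0}\ \frac1{m(B(X,\delta(X)/2))}\int_{B(X,\delta(X)/2)}u\,dm$$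 at the points $x\in\Gamma$ where this limit exists. **Theorem.** (a) For every $g\in L^1_{loc}(\Gamma,\mu)$, the limit defining $\operatorname{Tr}(\operatorname{Ext}g)(x)$ exists (as a limit along a nontrivial filter) for $\mu$-a.e. $x\in\Gamma$, and $\operatorname{Tr}\circ\operatorname{Ext}g=g$ $\mu$-a.e. on $\Gamma$. (b) $H\subset L^1_{loc}(\Gamma,\mu)$, and $\operatorname{Ext}$ is a bounded linear operator from $H$ to $W$: $\operatorname{Ext}$ is linear (on $L^1_{loc}(\Gamma,\mu)$), and there is a constant $C$ depending only on $n$, $K$, $C_3$, $C_4$, $C_5$ such that for every $g\in H$ one has $\operatorname{Ext}g\in W$, its gradient in $W$ is $m$-a.e. the classical gradient of $\operatorname{Ext}g$ on $\Omega$, and $$\int_\Omega|\nabla\operatorname{Ext}g|^2\,dm\le C\,\|g\|_H^2 .$$ -/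

import Mathlib

open MeasureTheory Filter Topology Set
open scoped ENNReal ContDiff

noncomputable section

namespace ExtThm

/-- Euclidean space `ℝⁿ`. -/
abbrev E (n : ℕ) := EuclideanSpace ℝ (Fin n)

variable {n : ℕ}

/-! ### Geometry of the domain -/

/-- `dist(A, B)`, the infimum of the distances between points of `A` and points of `B`
(used for nonempty sets only). -/
def setDist (A B : Set (E n)) : ℝ := ⨅ p : A × B, dist (p.1 : E n) (p.2 : E n)

/-- `δ(X) = dist(X, ∂Ω)`. -/
def bdDist (Ω : Set (E n)) (X : E n) : ℝ := Metric.infDist X (frontier Ω)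

/-- (H1) interior corkscrew condition. -/
def H1 (Ω : Set (E n)) (C₁ : ℝ) : Prop :=
  0 < C₁ ∧ ∀ x ∈ frontier Ω, ∀ r : ℝ, 0 < r → (Bornology.IsBounded Ω → r < Metric.diam Ω) →
    ∃ X ∈ Metric.ball x r, Metric.ball X (C₁⁻¹ * r) ⊆ Ω

/-- (H2) Harnack chains; `C₁` is the corkscrew constant, and the chains have `N + 1` points. -/
def H2 (Ω : Set (E n)) (C₁ : ℝ) (N : ℕ) : Prop :=
  ∀ r : ℝ, 0 < r → ∀ X ∈ Ω, ∀ Y ∈ Ω, r < bdDist Ω X → r < bdDist Ω Y → dist X Y ≤ 7 * C₁ * r →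
    ∃ Z : ℕ → E n, Z 0 = X ∧ Z N = Y ∧ (∀ i ≤ N, Z i ∈ Ω) ∧
      ∀ i < N, dist (Z i) (Z (i + 1)) < bdDist Ω (Z i) / 2

/-- (H3) `μ` is a locally finite measure with support `∂Ω`, and it is doubling. -/
def H3 (Ω : Set (E n)) (μ : Measure (E n)) (C₃ : ℝ) : Prop :=
  IsLocallyFiniteMeasure μ ∧ μ.support = frontier Ω ∧ 1 < C₃ ∧
    ∀ x ∈ frontier Ω, ∀ r : ℝ, 0 < r →
      μ (Metric.ball x (2 * r)) ≤ ENNReal.ofReal C₃ * μ (Metric.ball x r)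

/-- (H4) `m` is the measure on `Ω` with density `w ∈ L¹_loc(Ω)`, `w > 0` a.e. on `Ω`, and it is
doubling, including at points of the boundary. -/
def H4 (Ω : Set (E n)) (m : Measure (E n)) (C₄ : ℝ) : Prop :=
  (∃ w : E n → ℝ, LocallyIntegrableOn w Ω volume ∧
    (∀ᵐ X ∂(volume.restrict Ω), 0 < w X) ∧
    m = (volume.restrict Ω).withDensity (fun X => ENNReal.ofReal (w X))) ∧
  1 ≤ C₄ ∧
  ∀ X ∈ closure Ω, ∀ r : ℝ, 0 < r →
    m (Metric.ball X (2 * r) ∩ Ω) ≤ ENNReal.ofReal C₄ * m (Metric.ball X r ∩ Ω)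

/-- `ρ(x, r) = m(B(x,r) ∩ Ω) / (r μ(B(x,r)))`. -/
def rho (Ω : Set (E n)) (m μ : Measure (E n)) (x : E n) (r : ℝ) : ℝ :=
  m.real (Metric.ball x r ∩ Ω) / (r * μ.real (Metric.ball x r))

/-- (H5) compared growth of `m` and `μ`, with `ε = 1 / C₅`. -/
def H5 (Ω : Set (E n)) (m μ : Measure (E n)) (C₅ : ℝ) : Prop :=
  0 < C₅ ∧ ∀ x ∈ frontier Ω, ∀ s r : ℝ, 0 < s → s < r →
    rho Ω m μ x r / rho Ω m μ x s ≤ C₅ * (r / s) ^ (1 - C₅⁻¹)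

/-- (H6) closability of the gradient on relatively compact open subsets, and a weak Poincaré
inequality on interior balls. Functions of `C^∞` of a compact set are restrictions of smooth
functions on `ℝⁿ`. -/
def H6 (Ω : Set (E n)) (m : Measure (E n)) (C₆ : ℝ) : Prop :=
  (∀ D : Set (E n), IsOpen D → IsCompact (closure D) → closure D ⊆ Ω →
    ∀ (u : ℕ → E n → ℝ) (v : E n → E n), (∀ i, ContDiff ℝ ∞ (u i)) →
      MemLp v 2 (m.restrict D) →
      Tendsto (fun i => ∫⁻ X in D, ‖u i X‖ₑ ∂m) atTop (𝓝 0) →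
      Tendsto (fun i => ∫⁻ X in D, ‖gradient (u i) X - v X‖ₑ ^ 2 ∂m) atTop (𝓝 0) →
      v =ᵐ[m.restrict D] 0) ∧
  ∀ (X₀ : E n) (r : ℝ), 0 < r → Metric.ball X₀ (2 * r) ⊆ Ω →
    ∀ u : E n → ℝ, ContDiff ℝ ∞ u →
      (⨍ X in Metric.ball X₀ r, |u X - ⨍ Y in Metric.ball X₀ r, u Y ∂m| ∂m) ≤
        C₆ * r * Real.sqrt (⨍ X in Metric.ball X₀ r, ‖gradient u X‖ ^ 2 ∂m)

/-! ### The spaces `W` and `H` -/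

/-- `v` is a gradient of `u` in the sense of the weighted space `W`: `u ∈ L¹_loc(Ω, m)`,
`v ∈ L²(Ω, m)`, and there are `φᵢ ∈ C^∞(closure Ω)` (restrictions of smooth functions on `ℝⁿ`)
of finite energy with `φᵢ → u` in `L¹(B, m)` whenever `2B ⊆ Ω` and `∇φᵢ → v` in `L²(Ω, m)`. -/
def HasWGradient (Ω : Set (E n)) (m : Measure (E n)) (u : E n → ℝ) (v : E n → E n) : Prop :=
  LocallyIntegrableOn u Ω m ∧ MemLp v 2 (m.restrict Ω) ∧
  ∃ φ : ℕ → E n → ℝ, (∀ i, ContDiff ℝ ∞ (φ i)) ∧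
    (∀ i, ∫⁻ X in Ω, ‖gradient (φ i) X‖ₑ ^ 2 ∂m < ⊤) ∧
    (∀ (X₀ : E n) (r : ℝ), 0 < r → Metric.ball X₀ (2 * r) ⊆ Ω →
      Tendsto (fun i => ∫⁻ X in Metric.ball X₀ r, ‖φ i X - u X‖ₑ ∂m) atTop (𝓝 0)) ∧
    Tendsto (fun i => ∫⁻ X in Ω, ‖gradient (φ i) X - v X‖ₑ ^ 2 ∂m) atTop (𝓝 0)

/-- Membership in the energy space `W`. -/
def MemW (Ω : Set (E n)) (m : Measure (E n)) (u : E n → ℝ) : Prop :=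
  ∃ v, HasWGradient Ω m u v

/-- `‖g‖_H²`, as an extended nonnegative number. The values of `g` outside `∂Ω` do not matter,
since `μ` is carried by `∂Ω`. -/
def hEnergy (Ω : Set (E n)) (m μ : Measure (E n)) (g : E n → ℝ) : ℝ≥0∞ :=
  ∫⁻ x, ∫⁻ y, ENNReal.ofReal
    (rho Ω m μ x (dist x y) ^ 2 * |g x - g y| ^ 2 / m.real (Metric.ball x (dist x y) ∩ Ω)) ∂μ ∂μ

/-- Membership in the trace space `H`. -/
def MemH (Ω : Set (E n)) (m μ : Measure (E n)) (g : E n → ℝ) : Prop :=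
  AEMeasurable g μ ∧ hEnergy Ω m μ g < ⊤

/-! ### Dyadic and Whitney cubes -/

/-- The pair `(k, z)` stands for the dyadic cube `2^{-k} (z + [0,1]ⁿ)`. -/
abbrev Dyadic (n : ℕ) := ℤ × (Fin n → ℤ)

/-- Side length `ℓ(I)`. -/
def side (I : Dyadic n) : ℝ := (2 : ℝ) ^ (-I.1)

/-- Center `X_I`. -/
def center (I : Dyadic n) : E n := WithLp.toLp 2 (fun i => side I * ((I.2 i : ℝ) + 1 / 2))

/-- The dilated closed cube `t I`, with the same center as `I`. -/
def dilate (t : ℝ) (I : Dyadic n) : Set (E n) :=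
  {X | ∀ i, |X i - center I i| ≤ t * side I / 2}

/-- The closed dyadic cube itself. -/
def cube (I : Dyadic n) : Set (E n) := dilate 1 I

/-- The dyadic parent (integer division by `2` rounds down). -/
def parent (I : Dyadic n) : Dyadic n := (I.1 - 1, fun i => I.2 i / 2)

/-- `4 diam I ≤ dist(4I, ∂Ω)`. -/
def IsFar (Ω : Set (E n)) (I : Dyadic n) : Prop :=
  4 * Metric.diam (cube I) ≤ setDist (dilate 4 I) (frontier Ω)

/-- The Whitney decomposition of `Ω`. -/
def whitney (Ω : Set (E n)) : Set (Dyadic n) :=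
  {I | cube I ⊆ Ω ∧ IsFar Ω I ∧ ¬ IsFar Ω (parent I)}

/-- A smooth partition of unity subordinate to the doubled Whitney cubes. -/
structure IsWhitneyPartition (Ω : Set (E n)) (K : ℝ) (φ : Dyadic n → E n → ℝ) : Prop where
  smooth : ∀ I ∈ whitney Ω, ContDiff ℝ ∞ (φ I)
  support_subset : ∀ I ∈ whitney Ω, Function.support (φ I) ⊆ dilate 2 I
  nonneg : ∀ I ∈ whitney Ω, ∀ X, 0 ≤ φ I X
  le_one : ∀ I ∈ whitney Ω, ∀ X, φ I X ≤ 1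
  gradient_le : ∀ I ∈ whitney Ω, ∀ X, ‖gradient (φ I) X‖ ≤ K / side I
  sum_eq : ∀ X, ∑' I : whitney Ω, φ I X = Ω.indicator (fun _ => (1 : ℝ)) X

/-- Admissible centers: `ξ_I ∈ ∂Ω` with `dist(ξ_I, I) ≤ 2 dist(I, ∂Ω)`. -/
def IsWhitneyCenters (Ω : Set (E n)) (ξ : Dyadic n → E n) : Prop :=
  ∀ I ∈ whitney Ω, ξ I ∈ frontier Ω ∧
    Metric.infDist (ξ I) (cube I) ≤ 2 * setDist (cube I) (frontier Ω)

/-- The extension operator `Ext g = ∑_I φ_I ⨍_{B_I} g dμ`, where `B_I = B(ξ_I, ℓ(I))`. -/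
def ext (Ω : Set (E n)) (μ : Measure (E n)) (φ : Dyadic n → E n → ℝ) (ξ : Dyadic n → E n)
    (g : E n → ℝ) (X : E n) : ℝ :=
  ∑' I : whitney Ω, φ I X * ⨍ z in Metric.ball (ξ I) (side (I : Dyadic n)), g z ∂μ

/-! ### Access cones and traces -/

/-- A system of dyadic pseudocubes on `Γ`: `D k` is the collection of cubes of generation `k`. -/
structure IsDyadicSystem (Γ : Set (E n)) (D : ℤ → Set (Set (E n))) : Prop where
  measurable : ∀ k, ∀ Q ∈ D k, MeasurableSet Q
  cover : ∀ k, ⋃₀ D k = Γ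
  nested : ∀ k l, k ≤ l → ∀ Q ∈ D l, ∀ Q' ∈ D k, Q ⊆ Q' ∨ Disjoint Q Q'
  ancestor : ∀ k l, l < k → ∀ Q ∈ D k, ∃! Q', Q' ∈ D l ∧ Q ⊆ Q'
  diam_le : ∀ k, ∀ Q ∈ D k, ∀ x ∈ Q, ∀ y ∈ Q, dist x y ≤ (2 : ℝ) ^ (-k)
  inner_ball : ∃ a₀ : ℝ, 0 < a₀ ∧ ∀ k, ∀ Q ∈ D k, ∃ z ∈ Γ,
    Metric.ball z (a₀ * (2 : ℝ) ^ (-k)) ∩ Γ ⊆ Q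

/-- The Whitney region `U_Q` of a pseudocube `Q` of generation `k`: the union of the Whitney cubes
`I` with `ℓ(I) ≥ ℓ(Q) / C_a` and `dist(I, Q) ≤ 2 ℓ(Q)`, where `ℓ(Q) = 2^{-k}`. -/
def whitneyRegion (Ω : Set (E n)) (Ca : ℝ) (k : ℤ) (Q : Set (E n)) : Set (E n) :=
  ⋃ I ∈ {I ∈ whitney Ω | Ca⁻¹ * (2 : ℝ) ^ (-k) ≤ side I ∧
    setDist (cube I) Q ≤ 2 * (2 : ℝ) ^ (-k)}, cube I

/-- The dyadic access cone `γ(x)`. -/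
def cone (Ω : Set (E n)) (D : ℤ → Set (Set (E n))) (Ca : ℝ) (x : E n) : Set (E n) :=
  {X | ∃ k, ∃ Q ∈ D k, x ∈ Q ∧ X ∈ whitneyRegion Ω Ca k Q}

/-- The filter `X ∈ γ(x)`, `δ(X) → 0`. -/
def coneFilter (Ω : Set (E n)) (D : ℤ → Set (Set (E n))) (Ca : ℝ) (x : E n) : Filter (E n) :=
  comap (bdDist Ω) (𝓝 0) ⊓ 𝓟 (cone Ω D Ca x)

/-- The average `⨍_{B(X, δ(X)/2)} u dm`. -/
def interiorAvg (Ω : Set (E n)) (m : Measure (E n)) (u : E n → ℝ) (X : E n) : ℝ :=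
  ⨍ Z in Metric.ball X (bdDist Ω X / 2), u Z ∂m

/-- The nontangential limit of the averages of `u` exists at `x` and equals `a`
(the cone does approach the boundary, so `a` is determined by `u`). -/
def HasTraceAt (Ω : Set (E n)) (m : Measure (E n)) (D : ℤ → Set (Set (E n))) (Ca : ℝ)
    (u : E n → ℝ) (x : E n) (a : ℝ) : Prop :=
  (coneFilter Ω D Ca x).NeBot ∧ Tendsto (interiorAvg Ω m u) (coneFilter Ω D Ca x) (𝓝 a)

/-- The trace `Tr u`, meaningful at the points where the limit exists. -/
def trace (Ω : Set (E n)) (m : Measure (E n)) (D : ℤ → Set (Set (E n))) (Ca : ℝ)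
    (u : E n → ℝ) (x : E n) : ℝ :=
  limUnder (coneFilter Ω D Ca x) (interiorAvg Ω m u)

end ExtThm

end

namespace ExtThm

/-! ### Measures -/

/-! Near a point `X ∈ Ω` there are boundedly many Whitney cubes, their sides are comparable to
`δ(X)`, and each boundary ball `B_I` lies in `B(X, 13 δ(X))`, with comparable `μ`-mass by doubling.
Since `∑ φ_I = 1` in `Ω`, any constant `a` can be subtracted from all the averages at once. Thus
both `|Ext g - a|` and `δ(X) |∇ Ext g|` at `X` are bounded by a constant times the mean of `|g - a|`
over a ball of radius `≈ δ(X)` (`abs_ext_sub_le`, `abs_cubeAvg_sub_le`, `norm_gradient_ext_le`).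

Trace: take `a = g x`. In the cone at `x` one has `|X - x| ≲ δ(X)`, so the error is a mean of `|g -
g x|` over a ball centered at `x` that shrinks to `x`. This tends to zero at Lebesgue points of `μ`.
The corkscrew condition shows that the cone reaches the boundary.

Energy: take for `a` the mean of `g` and cut `Ω` into layers `δ(X) ∈ [2^j, 2^(j+1))`. Jensen's
inequality bounds the squared oscillation at scale `R ≈ 2^j` by a double integral of `|g(y) -
g(z)|²`. Integrating in `X` first, by Tonelli, produces the factor `m(B(y,R) ∩ Ω)`, hence the kernel
`kern y R = m / (R² μ²)`, restricted to `|y - z| < 2R`. The density of `‖g‖_H²` is this same kernel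
at radius `s = |y - z|`. (H5) gives `kern y R ≲ (s/R)^(1/C₅) kern y s` for `R > s/2`, so the sum
over scales is geometric (`kern_le`, `tsum_scaleEnergy_le`).

Membership in `W`: the approximants must be smooth on all of `ℝⁿ`. The cubes of side less than `t`
are discarded and replaced by a smooth local average `P` of `g` against `μ` (`exists_smoothAverage`,
`exists_approx`). The result is `Ext g` away from a layer of width `≈ t`. In that layer the energy
of the approximant is bounded by the energy of `g` at the single scale `≈ t`, a term of a convergent
series. The energy of `Ext g` there also tends to zero, the layers having empty intersection in `Ω`.
Finally (H6) makes the gradient unique, so the bound holds for every gradient in the sense of `W`.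
-/

/-- A measure carried by `Γ` that charges all balls centered on `Γ` and is doubling there. -/
structure IsDoublingOn {n : ℕ} (Γ : Set (E n)) (μ : Measure (E n)) (c : ℝ) : Prop where
  isClosed : IsClosed Γ
  nonempty : Γ.Nonempty
  null_compl : μ Γᶜ = 0
  pos : ∀ x ∈ Γ, ∀ r : ℝ, 0 < r → 0 < μ.real (Metric.ball x r)
  one_lt : 1 < c
  doubling : ∀ x ∈ Γ, ∀ r : ℝ, 0 < r →
    μ.real (Metric.ball x (2 * r)) ≤ c * μ.real (Metric.ball x r)

lemma H3.isDoublingOn {n : ℕ} {Ω : Set (E n)} {μ : Measure (E n)} {c : ℝ} (h : H3 Ω μ c)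
    (hΩ : (frontier Ω).Nonempty) : IsDoublingOn (frontier Ω) μ c := by
  obtain ⟨hl, hs, hc, hd⟩ := h
  refine ⟨isClosed_frontier, hΩ, ?_, fun x hx r hr => ?_, hc, fun x hx r hr => ?_⟩
  · rw [← hs]
    exact Measure.measure_compl_support
  · rw [← hs, Measure.mem_support_iff_forall] at hx
    exact ENNReal.toReal_pos (hx _ (Metric.ball_mem_nhds x hr)).ne' measure_ball_lt_top.ne
  · have := ENNReal.toReal_mono
      (ENNReal.mul_ne_top ENNReal.ofReal_ne_top measure_ball_lt_top.ne) (hd x hx r hr)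
    rwa [ENNReal.toReal_mul, ENNReal.toReal_ofReal (by linarith)] at this

namespace IsDoublingOn

variable {n : ℕ} {Γ : Set (E n)} {μ : Measure (E n)} {c : ℝ}

lemma ae_mem (h : IsDoublingOn Γ μ c) : ∀ᵐ x ∂μ, x ∈ Γ :=
  mem_ae_iff.2 h.null_compl

lemma measureReal_ball_two_pow_le (h : IsDoublingOn Γ μ c) {x : E n} (hx : x ∈ Γ) {r : ℝ}
    (hr : 0 < r) (p : ℕ) :
    μ.real (Metric.ball x (2 ^ p * r)) ≤ c ^ p * μ.real (Metric.ball x r) := by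
  induction p with
  | zero => simp
  | succ p ih =>
    calc μ.real (Metric.ball x (2 ^ (p + 1) * r))
        = μ.real (Metric.ball x (2 * (2 ^ p * r))) := by ring_nf
      _ ≤ c * μ.real (Metric.ball x (2 ^ p * r)) := h.doubling x hx _ (by positivity)
      _ ≤ c * (c ^ p * μ.real (Metric.ball x r)) := by
        have := h.one_lt
        gcongr
      _ = _ := by ring

lemma measureReal_le_of_subset [IsLocallyFiniteMeasure μ] (h : IsDoublingOn Γ μ c) {x : E n}
    (hx : x ∈ Γ) {r R : ℝ} (hr : 0 < r) {p : ℕ} (hR : R ≤ 2 ^ p * r) {S : Set (E n)}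
    (hS : S ⊆ Metric.ball x R) :
    μ.real S ≤ c ^ p * μ.real (Metric.ball x r) :=
  (measureReal_mono (hS.trans (Metric.ball_subset_ball hR)) measure_ball_lt_top.ne).trans
    (h.measureReal_ball_two_pow_le hx hr p)

end IsDoublingOn

/-! ### The interior measure: finite on balls, positive on open subsets of the domain. -/

section Interior

variable {n : ℕ} {Ω : Set (E n)} {m : Measure (E n)} {c : ℝ}

lemma H4.measure_compl (h : H4 Ω m c) (hΩ : IsOpen Ω) : m Ωᶜ = 0 := by
  obtain ⟨⟨w, -, -, rfl⟩, -⟩ := h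
  refine withDensity_absolutelyContinuous _ _ ?_
  rw [Measure.restrict_apply hΩ.measurableSet.compl]
  simp

lemma H4.restrict_eq (h : H4 Ω m c) (hΩ : IsOpen Ω) : m.restrict Ω = m :=
  Measure.restrict_eq_self_of_ae_mem (mem_ae_iff.2 (h.measure_compl hΩ))

lemma H4.measure_inter (h : H4 Ω m c) (hΩ : IsOpen Ω) (S : Set (E n)) : m (S ∩ Ω) = m S := by
  conv_rhs => rw [← h.restrict_eq hΩ, Measure.restrict_apply' hΩ.measurableSet]

/-- Local integrability of `w` in `Ω` says nothing about balls that reach the boundary. Finiteness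
on one small interior ball is propagated to all larger concentric balls by doubling. -/
lemma H4.measure_ball_lt_top (h : H4 Ω m c) (hΩ : IsOpen Ω) (hne : Ω.Nonempty) (X : E n) (r : ℝ) :
    m (Metric.ball X r) < ⊤ := by
  have hin := h.measure_inter hΩ
  obtain ⟨⟨w, hw, -, hm⟩, hc, hd⟩ := h
  obtain ⟨Y, hY⟩ := hne
  obtain ⟨s, hs, hsfin⟩ : ∃ s > 0, m (Metric.ball Y s) < ⊤ := by
    obtain ⟨t, ht, hint⟩ := hw Y hY
    rw [hΩ.nhdsWithin_eq hY, Metric.mem_nhds_iff] at ht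
    obtain ⟨s, hs, hst⟩ := ht
    refine ⟨s, hs, ?_⟩
    rw [hm, withDensity_apply _ measurableSet_ball, Measure.restrict_restrict measurableSet_ball]
    have := (hint.mono_set (inter_subset_left.trans hst : Metric.ball Y s ∩ Ω ⊆ t))
    exact lt_of_le_of_lt (lintegral_mono fun x => Real.ofReal_le_enorm _) this.2
  have key : ∀ p : ℕ, m (Metric.ball Y (2 ^ p * s)) < ⊤ := by
    intro p
    induction p with
    | zero => simpa using hsfin
    | succ p ih =>
      have := hd Y (subset_closure hY) (2 ^ p * s) (by positivity)
      rw [hin, hin, ← mul_assoc, ← pow_succ'] at this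
      exact this.trans_lt (ENNReal.mul_lt_top ENNReal.ofReal_lt_top ih)
  obtain ⟨p, hp⟩ := pow_unbounded_of_one_lt ((r + dist X Y) / s) (one_lt_two : (1 : ℝ) < 2)
  refine lt_of_le_of_lt (measure_mono (Metric.ball_subset_ball' ?_)) (key p)
  rw [div_lt_iff₀ hs] at hp
  exact hp.le

lemma H4.isLocallyFiniteMeasure (h : H4 Ω m c) (hΩ : IsOpen Ω) (hne : Ω.Nonempty) :
    IsLocallyFiniteMeasure m :=
  ⟨fun X => ⟨_, Metric.ball_mem_nhds X one_pos, h.measure_ball_lt_top hΩ hne X 1⟩⟩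

/-- Because `w > 0` almost everywhere, Lebesgue measure on `Ω` is absolutely continuous with respect
to `m`. -/
lemma H4.measure_pos (h : H4 Ω m c) {U : Set (E n)} (hU : IsOpen U) (hUΩ : U ⊆ Ω)
    (hne : U.Nonempty) : 0 < m U := by
  obtain ⟨⟨w, hw, hpos, hm⟩, -⟩ := h
  have hac : volume.restrict Ω ≪ m := by
    rw [hm]
    refine withDensity_absolutelyContinuous' ?_ ?_
    · exact hw.aestronglyMeasurable.aemeasurable.ennreal_ofReal
    · filter_upwards [hpos] with x hx
      simpa using hx
  rw [pos_iff_ne_zero]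
  intro h0
  have := hac h0
  rw [Measure.restrict_apply hU.measurableSet, inter_eq_self_of_subset_left hUΩ] at this
  exact (hU.measure_pos volume hne).ne' this

end Interior

/-! ### Geometry of Whitney cubes -/

section Dyadic

variable {n : ℕ}

lemma side_pos (I : Dyadic n) : 0 < side I := by
  unfold side; positivity

lemma side_parent (I : Dyadic n) : side (parent I) = 2 * side I := by
  unfold side parent
  rw [show -((I.1 - 1 : ℤ), fun i => I.2 i / 2).1 = -I.1 + 1 by simp; ring,
    zpow_add₀ two_ne_zero]
  ring

lemma dist_le_sqrt_mul {X Y : E n} {t : ℝ} (ht : 0 ≤ t) (h : ∀ i, |X i - Y i| ≤ t) :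
    dist X Y ≤ √n * t := by
  rw [EuclideanSpace.dist_eq]
  calc √(∑ i, dist (X i) (Y i) ^ 2) ≤ √(∑ _i : Fin n, t ^ 2) := by
        gcongr with i
        exact h i
    _ = √n * t := by
        simp [Real.sqrt_mul, Real.sqrt_sq ht]

lemma abs_apply_sub_le_dist (X Y : E n) (i : Fin n) : |X i - Y i| ≤ dist X Y := by
  rw [dist_eq_norm]
  exact PiLp.norm_apply_le (X - Y) i

lemma dist_center_le {t : ℝ} (ht : 0 ≤ t) {I : Dyadic n} {X : E n} (hX : X ∈ dilate t I) :
    dist X (center I) ≤ √n * (t * side I / 2) :=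
  dist_le_sqrt_mul (by have := side_pos I; positivity) hX

lemma center_mem_dilate {t : ℝ} (ht : 0 ≤ t) (I : Dyadic n) : center I ∈ dilate t I := by
  have := side_pos I
  intro i
  simp only [sub_self, abs_zero]
  positivity

lemma dilate_mono {s t : ℝ} (h : s ≤ t) (I : Dyadic n) : dilate s I ⊆ dilate t I := by
  have := side_pos I
  intro X hX i
  exact (hX i).trans (by gcongr)

lemma dist_le_of_mem_cube {I : Dyadic n} {X Y : E n} (hX : X ∈ cube I) (hY : Y ∈ cube I) :
    dist X Y ≤ √n * side I := by
  have h1 := dist_center_le zero_le_one hX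
  have h2 := dist_center_le zero_le_one hY
  have := dist_triangle_right X Y (center I)
  linarith

lemma isBounded_cube (I : Dyadic n) : Bornology.IsBounded (cube I) :=
  Metric.isBounded_iff.2 ⟨_, fun _ hX _ hY => dist_le_of_mem_cube hX hY⟩

lemma diam_cube_le (I : Dyadic n) : Metric.diam (cube I) ≤ √n * side I :=
  Metric.diam_le_of_forall_dist_le (by have := side_pos I; positivity)
    fun _ hX _ hY => dist_le_of_mem_cube hX hY

lemma le_diam_cube (I : Dyadic n) : √n * side I ≤ Metric.diam (cube I) := by
  have hs := side_pos I
  let X : E n := WithLp.toLp 2 (fun i => center I i + side I / 2)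
  let Y : E n := WithLp.toLp 2 (fun i => center I i - side I / 2)
  have hX : X ∈ cube I := fun i => by
    simp only [X, add_sub_cancel_left, one_mul]
    rw [abs_of_pos (by positivity)]
  have hY : Y ∈ cube I := fun i => by
    simp only [Y, sub_sub_cancel_left, one_mul]
    rw [abs_neg, abs_of_pos (by positivity)]
  refine le_trans (le_of_eq ?_) (Metric.dist_le_diam_of_mem (isBounded_cube I) hX hY)
  rw [EuclideanSpace.dist_eq]
  have : ∀ i, dist (X i) (Y i) ^ 2 = side I ^ 2 := fun i => by
    simp only [X, Y, Real.dist_eq, sq_abs]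
    ring
  simp [this, Real.sqrt_mul, Real.sqrt_sq hs.le]

lemma convex_dilate (t : ℝ) (I : Dyadic n) : Convex ℝ (dilate t I) := by
  have : dilate t I = ⋂ i, (fun X : E n => X i) ⁻¹' Metric.closedBall (center I i) (t * side I / 2) := by
    ext X
    simp [dilate, Real.dist_eq]
  rw [this]
  refine convex_iInter fun i => ?_
  exact (convex_closedBall _ _).linear_preimage (EuclideanSpace.proj i : E n →L[ℝ] ℝ).toLinearMap

/-- Writing the index as `2q + r` with `r ∈ {0, 1}`, the offset is `(r - 1/2) side I`. -/
lemma abs_center_sub_center_parent_le (I : Dyadic n) (i : Fin n) :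
    |center I i - center (parent I) i| ≤ side I / 2 := by
  have hs := side_pos I
  have h1 : center (parent I) i = 2 * side I * (((I.2 i / 2 : ℤ) : ℝ) + 1 / 2) := by
    simp only [center, side_parent]
    rfl
  have h2 : center I i = side I * ((I.2 i : ℝ) + 1 / 2) := rfl
  have h3 : ((I.2 i : ℤ) : ℝ) = 2 * ((I.2 i / 2 : ℤ) : ℝ) + ((I.2 i % 2 : ℤ) : ℝ) := by
    exact_mod_cast (Int.mul_ediv_add_emod (I.2 i) 2).symm
  rw [h1, h2, h3]
  rcases Int.emod_two_eq_zero_or_one (I.2 i) with h | h <;> rw [h, abs_le] <;>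
    constructor <;> push_cast <;> nlinarith

end Dyadic

/-! ### Distances to the boundary. -/

section SetDist

variable {n : ℕ}

lemma setDist_le_dist {A B : Set (E n)} {X Y : E n} (hX : X ∈ A) (hY : Y ∈ B) :
    setDist A B ≤ dist X Y :=
  ciInf_le (f := fun p : A × B => dist (p.1 : E n) (p.2 : E n))
    ⟨0, by rintro _ ⟨p, rfl⟩; exact dist_nonneg⟩ (⟨X, hX⟩, ⟨Y, hY⟩)

lemma exists_dist_lt_of_setDist_lt {A B : Set (E n)} (hA : A.Nonempty) (hB : B.Nonempty) {t : ℝ}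
    (h : setDist A B < t) : ∃ X ∈ A, ∃ Y ∈ B, dist X Y < t := by
  have := hA.to_subtype
  have := hB.to_subtype
  obtain ⟨p, hp⟩ := exists_lt_of_ciInf_lt h
  exact ⟨p.1, p.1.2, p.2, p.2.2, hp⟩

lemma setDist_le_bdDist {Ω : Set (E n)} (hne : (frontier Ω).Nonempty) {A : Set (E n)} {X : E n}
    (hX : X ∈ A) : setDist A (frontier Ω) ≤ bdDist Ω X :=
  (Metric.le_infDist hne).2 fun _ hY => setDist_le_dist hX hY

lemma bdDist_le_add_dist (Ω : Set (E n)) (X Y : E n) : bdDist Ω X ≤ bdDist Ω Y + dist X Y :=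
  Metric.infDist_le_infDist_add_dist

lemma continuous_bdDist (Ω : Set (E n)) : Continuous (bdDist Ω) :=
  Metric.continuous_infDist_pt _

lemma bdDist_pos {Ω : Set (E n)} (hΩ : IsOpen Ω) (hne : (frontier Ω).Nonempty) {X : E n}
    (hX : X ∈ Ω) : 0 < bdDist Ω X := by
  refine (isClosed_frontier.notMem_iff_infDist_pos hne).1 fun h => ?_
  exact (hΩ.frontier_eq ▸ h).2 hX

/-- A connected set that misses the frontier cannot meet both the interior and the exterior. This is
how balls and dilated cubes are placed inside `Ω`. -/
lemma subset_of_isPreconnected {Ω S : Set (E n)} (hS : IsPreconnected S)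
    (hfr : ∀ X ∈ S, X ∉ frontier Ω) (hne : (S ∩ Ω).Nonempty) : S ⊆ Ω := by
  by_contra hsub
  obtain ⟨Y, hYS, hY⟩ := not_subset.1 hsub
  have hin : ∀ X ∈ S, X ∈ closure Ω → X ∈ interior Ω := fun X hX hc => by
    by_contra h
    exact hfr X hX ⟨hc, h⟩
  obtain ⟨Z, hZS, hZ⟩ := hne
  obtain ⟨X, -, hX, hX'⟩ := hS (interior Ω) (closure Ω)ᶜ isOpen_interior isClosed_closure.isOpen_compl
    (fun X hX => or_iff_not_imp_right.2 fun h => hin X hX (not_not.1 h))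
    ⟨Z, hZS, hin Z hZS (subset_closure hZ)⟩
    ⟨Y, hYS, fun h => hY (interior_subset (hin Y hYS h))⟩
  exact hX' (subset_closure (interior_subset hX))

lemma ball_bdDist_subset {Ω : Set (E n)} {X : E n} (hX : X ∈ Ω) :
    Metric.ball X (bdDist Ω X) ⊆ Ω := by
  by_cases hb : 0 < bdDist Ω X
  · refine subset_of_isPreconnected (convex_ball _ _).isPreconnected (fun Y hY hf => ?_)
      ⟨X, Metric.mem_ball_self hb, hX⟩
    have := Metric.infDist_le_dist_of_mem (x := X) hf
    rw [Metric.mem_ball, dist_comm] at hY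
    exact absurd this (not_le.2 hY)
  · rw [Metric.ball_eq_empty.2 (not_lt.1 hb)]
    exact empty_subset _

lemma exists_mem_frontier_dist_lt {Ω : Set (E n)} (hne : (frontier Ω).Nonempty) {X : E n} {t : ℝ}
    (h : bdDist Ω X < t) : ∃ x ∈ frontier Ω, dist X x < t :=
  (Metric.infDist_lt_iff hne).1 h

end SetDist

/-! ### Whitney cubes have side comparable to the distance to the boundary, and few are near a
point. -/

section Whitney

variable {n : ℕ} {Ω : Set (E n)} {I : Dyadic n}

lemma four_mul_side_le_bdDist (hne : (frontier Ω).Nonempty) (hI : I ∈ whitney Ω) {X : E n}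
    (hX : X ∈ dilate 4 I) : 4 * (√n * side I) ≤ bdDist Ω X := by
  have h1 := le_diam_cube I
  have h2 : 4 * Metric.diam (cube I) ≤ _ := hI.2.1
  have h3 := setDist_le_bdDist hne hX
  linarith

lemma dilate_subset (hn : 0 < n) (hne : (frontier Ω).Nonempty) (hI : I ∈ whitney Ω) :
    dilate 4 I ⊆ Ω := by
  refine subset_of_isPreconnected (convex_dilate _ _).isPreconnected (fun X hX hf => ?_)
    ⟨center I, center_mem_dilate (by norm_num) I, hI.1 (center_mem_dilate zero_le_one I)⟩
  have h := four_mul_side_le_bdDist hne hI hX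
  rw [show bdDist Ω X = 0 from Metric.infDist_zero_of_mem hf] at h
  have : 0 < √n * side I := mul_pos (Real.sqrt_pos.2 (by exact_mod_cast hn)) (side_pos I)
  linarith

/-- The parent is not far: some `Y` in its fourfold dilate is within `4 diam ≤ 8 √n side I` of the
boundary. Each coordinate of `X - Y` is at most `(1 + 1/2 + 4) side I`, rounded up to `6 side I`,
and `14 = 8 + 6`. -/
lemma bdDist_le_mul_side (hne : (frontier Ω).Nonempty) (hI : I ∈ whitney Ω) {X : E n}
    (hX : X ∈ dilate 2 I) : bdDist Ω X ≤ 14 * (√n * side I) := by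
  have hs := side_pos I
  have h1 : setDist (dilate 4 (parent I)) (frontier Ω) < 4 * Metric.diam (cube (parent I)) :=
    not_le.1 hI.2.2
  obtain ⟨Y, hY, p, hp, hd⟩ := exists_dist_lt_of_setDist_lt
    ⟨center (parent I), center_mem_dilate (by norm_num) _⟩ hne h1
  have h2 := diam_cube_le (parent I)
  rw [side_parent] at h2
  have h3 : dist X Y ≤ √n * (6 * side I) := by
    refine dist_le_sqrt_mul (by positivity) fun i => ?_
    have e1 := hX i
    have e2 := hY i
    have e3 := abs_center_sub_center_parent_le I i
    rw [side_parent] at e2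
    rw [abs_le] at *
    constructor <;> linarith [e1.1, e1.2, e2.1, e2.2, e3.1, e3.2]
  have h4 : bdDist Ω X ≤ dist X p := Metric.infDist_le_dist_of_mem hp
  linarith [dist_triangle X Y p]

lemma dist_whitneyCenter_le {ξ : Dyadic n → E n} (hn : 0 < n) (hξ : IsWhitneyCenters Ω ξ)
    (hne : (frontier Ω).Nonempty) (hI : I ∈ whitney Ω) {X : E n} (hX : X ∈ dilate 2 I) :
    dist (ξ I) X ≤ 31 * (√n * side I) := by
  have hpos : 0 < √n * side I := mul_pos (Real.sqrt_pos.2 (by exact_mod_cast hn)) (side_pos I)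
  have hc1 : center I ∈ cube I := center_mem_dilate zero_le_one I
  have h1 := (hξ I hI).2
  have h2 := setDist_le_bdDist hne hc1
  have h3 := bdDist_le_mul_side hne hI (center_mem_dilate zero_le_two I)
  -- The distance is at most `2 · 14`; `29` gives the strict inequality needed to select a point of
  -- the cube.
  obtain ⟨q, hq, hd⟩ := (Metric.infDist_lt_iff ⟨_, hc1⟩ (x := ξ I) (r := 29 * (√n * side I))).1
    (by linarith)
  have h4 := dist_center_le zero_le_one hq
  have h5 := dist_center_le zero_le_two hX
  have := dist_triangle4 (ξ I) q (center I) X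
  rw [dist_comm X] at h5
  linarith

/-- The Whitney cubes whose double meets `B(X, δ(X)/2)`. -/
def nearCubes (Ω : Set (E n)) (X : E n) : Set (Dyadic n) :=
  {I ∈ whitney Ω | (dilate 2 I ∩ Metric.ball X (bdDist Ω X / 2)).Nonempty}

lemma bdDist_le_of_mem_nearCubes (hne : (frontier Ω).Nonempty) {X : E n} (hI : I ∈ nearCubes Ω X) :
    bdDist Ω X ≤ 28 * (√n * side I) := by
  obtain ⟨hI, Z, hZ, hZX⟩ := hI
  have h1 := bdDist_le_mul_side hne hI hZ
  have h2 := bdDist_le_add_dist Ω X Z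
  rw [Metric.mem_ball, dist_comm] at hZX
  linarith

lemma side_le_of_mem_nearCubes (hne : (frontier Ω).Nonempty) {X : E n} (hI : I ∈ nearCubes Ω X) :
    8 * (√n * side I) ≤ 3 * bdDist Ω X := by
  obtain ⟨hI, Z, hZ, hZX⟩ := hI
  have h1 := four_mul_side_le_bdDist hne hI (dilate_mono (by norm_num) I hZ)
  have h2 := bdDist_le_add_dist Ω Z X
  rw [Metric.mem_ball] at hZX
  linarith

/-- A bound for the number of Whitney cubes near a point. -/
def nearCount (n : ℕ) : ℕ := 7 * (30 * n + 2) ^ n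

/-- Sides of near cubes are all comparable to `δ(X)`, which leaves `7` generations. In each of them
every coordinate of the index lies in a window of `30 n + 2` integers determined by `X`. -/
lemma nearCubes_subset_finset (hn : 0 < n) (hΩ : IsOpen Ω) (hne : (frontier Ω).Nonempty) {X : E n}
    (hX : X ∈ Ω) : ∃ F : Finset (Dyadic n), nearCubes Ω X ⊆ F ∧ F.card ≤ nearCount n := by
  classical
  rcases (nearCubes Ω X).eq_empty_or_nonempty with he | ⟨J, hJ⟩
  · exact ⟨∅, by simp [he], by simp⟩
  have hδ := bdDist_pos hΩ hne hX
  have hsq : 1 ≤ √(n : ℝ) := Real.one_le_sqrt.2 (by exact_mod_cast hn)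
  have hsqn : √(n : ℝ) ≤ n := (Real.sqrt_le_left (by positivity)).2
    (by have : (1 : ℝ) ≤ n := by exact_mod_cast hn
        nlinarith)
  have hratio : ∀ {I J}, I ∈ nearCubes Ω X → J ∈ nearCubes Ω X → I.1 ≤ J.1 + 3 := by
    intro I J hI hJ
    have h1 := bdDist_le_of_mem_nearCubes hne hI
    have h2 := side_le_of_mem_nearCubes hne hJ
    have h3 : side J < 16 * side I := by
      by_contra! h
      have := side_pos I
      have : √(n : ℝ) * (16 * side I) ≤ √n * side J := by gcongr
      nlinarith
    -- The ratio of two sides is at most `3 · 28 / 8 < 16 = 2 ^ 4`, so generations differ by at most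
    -- `3`.
    unfold side at h3
    rw [show (16 : ℝ) = 2 ^ (4 : ℤ) by norm_num, ← zpow_add₀ two_ne_zero,
      zpow_lt_zpow_iff_right₀ one_lt_two] at h3
    omega
  let G : ℤ → Finset (Dyadic n) := fun k =>
    (Fintype.piFinset fun i : Fin n =>
      Finset.Icc (⌊(2 : ℝ) ^ k * X i - 1 / 2⌋ - 15 * n) (⌊(2 : ℝ) ^ k * X i - 1 / 2⌋ + 15 * n + 1)).image
      (Prod.mk k)
  refine ⟨(Finset.Icc (J.1 - 3) (J.1 + 3)).biUnion G, fun I hI => ?_, ?_⟩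
  · have h1 := hratio hI hJ
    have h2 := hratio hJ hI
    simp only [Finset.coe_biUnion, mem_iUnion]
    refine ⟨I.1, by simp; omega, ?_⟩
    simp only [G, Finset.coe_image, mem_image, Finset.mem_coe, Fintype.mem_piFinset,
      Finset.mem_Icc]
    refine ⟨I.2, fun i => ?_, rfl⟩
    -- `side I` for the dilated cube, plus `δ(X)/2 ≤ 14 √n side I`.
    have h3 : |X i - center I i| ≤ 15 * n * side I := by
      have hs := side_pos I
      have hb := bdDist_le_of_mem_nearCubes hne hI
      obtain ⟨hI, Z, hZ, hZX⟩ := hI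
      have e1 := hZ i
      have e2 := abs_apply_sub_le_dist Z X i
      rw [Metric.mem_ball] at hZX
      have e3 : √n * side I ≤ n * side I := by gcongr
      have e4 : side I ≤ n * side I := by nlinarith
      rw [abs_le] at *
      constructor <;> linarith [e1.1, e1.2, e2.1, e2.2]
    have h4 : X i - center I i = side I * (((2 : ℝ) ^ I.1 * X i - 1 / 2) - I.2 i) := by
      have : side I * (2 : ℝ) ^ I.1 = 1 := by
        unfold side
        rw [← zpow_add₀ two_ne_zero]; simp
      have hc : center I i = side I * ((I.2 i : ℝ) + 1 / 2) := rfl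
      rw [hc]
      linear_combination (- X i) * this
    rw [h4, abs_mul, abs_of_pos (side_pos I), mul_comm, mul_le_mul_iff_left₀ (side_pos I),
      abs_le] at h3
    have f1 := Int.floor_le ((2 : ℝ) ^ I.1 * X i - 1 / 2)
    have f2 := Int.lt_floor_add_one ((2 : ℝ) ^ I.1 * X i - 1 / 2)
    constructor
    · have : ((⌊(2 : ℝ) ^ I.1 * X i - 1 / 2⌋ : ℤ) : ℝ) - 15 * n ≤ I.2 i := by linarith [h3.1, h3.2]
      exact_mod_cast this
    · have : ((I.2 i : ℤ) : ℝ) ≤ ((⌊(2 : ℝ) ^ I.1 * X i - 1 / 2⌋ : ℤ) : ℝ) + 15 * n + 1 := by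
        linarith [h3.1, h3.2]
      exact_mod_cast this
  · refine (Finset.card_biUnion_le_card_mul _ _ ((30 * n + 2) ^ n) fun k _ => ?_).trans
      (le_of_eq ?_)
    · refine Finset.card_image_le.trans (le_of_eq ?_)
      rw [Fintype.card_piFinset]
      simp only [Int.card_Icc]
      rw [Finset.prod_congr rfl fun i _ => show _ = 30 * n + 2 by omega]
      simp
    · rw [Int.card_Icc, nearCount]
      congr 1
      omega

lemma finite_nearCubes (hn : 0 < n) (hΩ : IsOpen Ω) (hne : (frontier Ω).Nonempty) {X : E n}
    (hX : X ∈ Ω) : (nearCubes Ω X).Finite := by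
  obtain ⟨F, hF, -⟩ := nearCubes_subset_finset hn hΩ hne hX
  exact F.finite_toSet.subset hF

end Whitney

/-! ### The extension operator inside `Ω` -/

lemma norm_gradient {n : ℕ} (f : E n → ℝ) (X : E n) : ‖gradient f X‖ = ‖fderiv ℝ f X‖ :=
  LinearIsometryEquiv.norm_map _ _

/-- The mean of `g - a` over the small set is at most its absolute integral over the large set
divided by the small mass; `D` pays for the change of normalization. -/
lemma abs_average_sub_le {n : ℕ} {μ : Measure (E n)} {S U : Set (E n)} {g : E n → ℝ} {D : ℝ}
    (hSU : S ⊆ U) (hU : μ U ≠ ⊤) (hSpos : 0 < μ.real S)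
    (hD : μ.real U ≤ D * μ.real S) (hg : IntegrableOn g U μ) (a : ℝ) :
    |(⨍ z in S, g z ∂μ) - a| ≤ D * ⨍ z in U, |g z - a| ∂μ := by
  have hS : μ S ≠ ⊤ := measure_ne_top_of_subset hSU hU
  have hUpos : 0 < μ.real U := hSpos.trans_le (measureReal_mono hSU hU)
  have hint : IntegrableOn (fun z => g z - a) U μ := hg.sub (integrableOn_const hU)
  have h1 : (⨍ z in S, g z ∂μ) - a = (μ.real S)⁻¹ * ∫ z in S, (g z - a) ∂μ := by
    rw [integral_sub (hg.mono_set hSU) (integrableOn_const hS), setAverage_eq, setIntegral_const]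
    simp only [smul_eq_mul]
    field_simp
  rw [h1, abs_mul, abs_of_pos (inv_pos.2 hSpos), setAverage_eq, smul_eq_mul]
  calc (μ.real S)⁻¹ * |∫ z in S, (g z - a) ∂μ|
      ≤ (μ.real S)⁻¹ * ∫ z in U, |g z - a| ∂μ := by
        gcongr
        exact (abs_integral_le_integral_abs).trans (setIntegral_mono_set hint.abs
          (Eventually.of_forall fun _ => abs_nonneg _) (Eventually.of_forall hSU))
    _ ≤ (D * (μ.real U)⁻¹) * ∫ z in U, |g z - a| ∂μ := by
        refine mul_le_mul_of_nonneg_right ?_ (integral_nonneg fun _ => abs_nonneg _)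
        rw [← div_eq_mul_inv, le_div_iff₀ hUpos, inv_mul_le_iff₀ hSpos]
        linarith
    _ = _ := by ring

/-- The standing assumptions on the domain, the boundary measure, and the data of the extension
operator. -/
structure ExtensionSetting {n : ℕ} (Ω : Set (E n)) (μ : Measure (E n)) (c K : ℝ)
    (φ : Dyadic n → E n → ℝ) (ξ : Dyadic n → E n) : Prop where
  dim_pos : 0 < n
  isOpen : IsOpen Ω
  doubling : IsDoublingOn (frontier Ω) μ c
  partition : IsWhitneyPartition Ω K φ
  centers : IsWhitneyCenters Ω ξ

namespace ExtensionSetting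

variable {n : ℕ} {Ω : Set (E n)} {μ : Measure (E n)} {c K : ℝ} {φ : Dyadic n → E n → ℝ}
  {ξ : Dyadic n → E n}

lemma one_le_sqrt (h : ExtensionSetting Ω μ c K φ ξ) : 1 ≤ √(n : ℝ) :=
  Real.one_le_sqrt.2 (by exact_mod_cast h.dim_pos)

lemma sqrt_le (h : ExtensionSetting Ω μ c K φ ξ) : √(n : ℝ) ≤ n :=
  (Real.sqrt_le_left (by positivity)).2
    (by have : (1 : ℝ) ≤ n := by exact_mod_cast h.dim_pos
        nlinarith)

lemma side_le_sqrt_mul (h : ExtensionSetting Ω μ c K φ ξ) (I : Dyadic n) :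
    side I ≤ √n * side I :=
  le_mul_of_one_le_left (side_pos I).le h.one_le_sqrt

lemma phi_eq_zero (h : ExtensionSetting Ω μ c K φ ξ) {X : E n} (hX : X ∉ Ω) {I : Dyadic n}
    (hI : I ∈ whitney Ω) : φ I X = 0 := by
  by_contra hne
  exact hX (dilate_subset h.dim_pos h.doubling.nonempty hI
    (dilate_mono (by norm_num) I (h.partition.support_subset I hI hne)))

lemma mem_nearCubes (h : ExtensionSetting Ω μ c K φ ξ) {X Z : E n} {I : Dyadic n}
    (hI : I ∈ whitney Ω) (hZ : Z ∈ Metric.ball X (bdDist Ω X / 2)) (hφ : φ I Z ≠ 0) :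
    I ∈ nearCubes Ω X :=
  ⟨hI, Z, h.partition.support_subset I hI hφ, hZ⟩

/-- The finite set of Whitney cubes near `X ∈ Ω`. -/
lemma exists_finset (h : ExtensionSetting Ω μ c K φ ξ) {X : E n} (hX : X ∈ Ω) :
    ∃ F : Finset (Dyadic n), (F : Set (Dyadic n)) = nearCubes Ω X ∧ F.card ≤ nearCount n := by
  obtain ⟨G, hG, hcard⟩ := nearCubes_subset_finset h.dim_pos h.isOpen h.doubling.nonempty hX
  refine ⟨(finite_nearCubes h.dim_pos h.isOpen h.doubling.nonempty hX).toFinset, by simp,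
    (Finset.card_le_card ?_).trans hcard⟩
  simpa using hG

/-- A single finite index set serves for all `Z` in `B(X, δ(X)/2)`. The series is thus a fixed
finite sum near `X`, which can be differentiated term by term. -/
lemma tsum_eq_sum (h : ExtensionSetting Ω μ c K φ ξ) {X Z : E n}
    (hZ : Z ∈ Metric.ball X (bdDist Ω X / 2)) {F : Finset (Dyadic n)}
    (hF : (F : Set (Dyadic n)) = nearCubes Ω X) (a : Dyadic n → ℝ) :
    ∑' I : whitney Ω, φ I Z * a I = ∑ I ∈ F, φ I Z * a I := by
  have hmem : ∀ I, I ∈ F ↔ I ∈ nearCubes Ω X := fun I => by rw [← hF, Finset.mem_coe]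
  rw [tsum_subtype (whitney Ω) fun I => φ I Z * a I, _root_.tsum_eq_sum (s := F)]
  · exact Finset.sum_congr rfl fun I hI => indicator_of_mem ((hmem I).1 hI).1 _
  · intro I hI
    refine indicator_apply_eq_zero.2 fun hIW => ?_
    by_contra hne
    exact hI ((hmem I).2 (h.mem_nearCubes hIW hZ (left_ne_zero_of_mul hne)))

lemma mem_of_mem_ball (h : ExtensionSetting Ω μ c K φ ξ) {X Z : E n} (hX : X ∈ Ω)
    (hZ : Z ∈ Metric.ball X (bdDist Ω X / 2)) : Z ∈ Ω := by
  have := bdDist_pos h.isOpen h.doubling.nonempty hX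
  exact ball_bdDist_subset hX (Metric.ball_subset_ball (by linarith) hZ)

lemma mem_ball_self (h : ExtensionSetting Ω μ c K φ ξ) {X : E n} (hX : X ∈ Ω) :
    X ∈ Metric.ball X (bdDist Ω X / 2) :=
  Metric.mem_ball_self (half_pos (bdDist_pos h.isOpen h.doubling.nonempty hX))

lemma sum_eq_one (h : ExtensionSetting Ω μ c K φ ξ) {X Z : E n} (hX : X ∈ Ω)
    (hZ : Z ∈ Metric.ball X (bdDist Ω X / 2)) {F : Finset (Dyadic n)}
    (hF : (F : Set (Dyadic n)) = nearCubes Ω X) : ∑ I ∈ F, φ I Z = 1 := by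
  have h1 := h.tsum_eq_sum hZ hF fun _ => 1
  simp only [mul_one] at h1
  rw [← h1, h.partition.sum_eq, indicator_of_mem (h.mem_of_mem_ball hX hZ)]

lemma phi_nonneg (h : ExtensionSetting Ω μ c K φ ξ) {X : E n} {F : Finset (Dyadic n)}
    (hF : (F : Set (Dyadic n)) = nearCubes Ω X) (Z : E n) : ∀ I ∈ F, 0 ≤ φ I Z := fun I hI =>
  h.partition.nonneg I (show I ∈ nearCubes Ω X from hF ▸ hI).1 Z

lemma abs_phi_sub_le (h : ExtensionSetting Ω μ c K φ ξ) {I : Dyadic n} (hI : I ∈ whitney Ω)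
    (X Y : E n) : |φ I Y - φ I X| ≤ |K| / side I * ‖Y - X‖ := by
  refine Convex.norm_image_sub_le_of_norm_fderiv_le (𝕜 := ℝ) (f := φ I)
    (fun Z _ => ((h.partition.smooth I hI).differentiable (by simp)) Z) (fun Z _ => ?_)
    convex_univ (mem_univ X) (mem_univ Y)
  rw [← norm_gradient]
  refine (h.partition.gradient_le I hI Z).trans ?_
  have := side_pos I
  gcongr
  exact le_abs_self K

/-- `⨍_{B_I} g dμ`. -/
noncomputable def cubeAvg (μ : Measure (E n)) (ξ : Dyadic n → E n) (g : E n → ℝ) (I : Dyadic n) :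
    ℝ :=
  ⨍ z in Metric.ball (ξ I) (side I), g z ∂μ

lemma ext_eq_sum (h : ExtensionSetting Ω μ c K φ ξ) {X Z : E n}
    (hZ : Z ∈ Metric.ball X (bdDist Ω X / 2)) {F : Finset (Dyadic n)}
    (hF : (F : Set (Dyadic n)) = nearCubes Ω X) (g : E n → ℝ) :
    ext Ω μ φ ξ g Z = ∑ I ∈ F, φ I Z * cubeAvg μ ξ g I :=
  h.tsum_eq_sum hZ hF (cubeAvg μ ξ g)

lemma ext_eq_zero (h : ExtensionSetting Ω μ c K φ ξ) {X : E n} (hX : X ∉ Ω) (g : E n → ℝ) :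
    ext Ω μ φ ξ g X = 0 := by
  unfold ext
  simp [fun I : whitney Ω => h.phi_eq_zero hX I.2]

lemma contDiffAt_ext (h : ExtensionSetting Ω μ c K φ ξ) (g : E n → ℝ) {X : E n} (hX : X ∈ Ω) :
    ContDiffAt ℝ ∞ (ext Ω μ φ ξ g) X := by
  obtain ⟨F, hF, -⟩ := h.exists_finset hX
  have hs : ContDiff ℝ ∞ fun Z => ∑ I ∈ F, φ I Z * cubeAvg μ ξ g I :=
    ContDiff.sum fun I hI =>
      (h.partition.smooth I (show I ∈ nearCubes Ω X from hF ▸ hI).1).mul contDiff_const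
  refine hs.contDiffAt.congr_of_eventuallyEq ?_
  filter_upwards [Metric.isOpen_ball.mem_nhds (h.mem_ball_self hX)] with Z hZ
  exact h.ext_eq_sum hZ hF g

lemma continuousOn_ext (h : ExtensionSetting Ω μ c K φ ξ) (g : E n → ℝ) :
    ContinuousOn (ext Ω μ φ ξ g) Ω := fun _ hX =>
  (h.contDiffAt_ext g hX).continuousAt.continuousWithinAt

lemma continuousOn_gradient_ext (h : ExtensionSetting Ω μ c K φ ξ) (g : E n → ℝ) :
    ContinuousOn (gradient (ext Ω μ φ ξ g)) Ω := fun _ hX =>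
  ((InnerProductSpace.toDual ℝ (E n)).symm.continuous.continuousAt.comp
    ((h.contDiffAt_ext g hX).continuousAt_fderiv (by simp))).continuousWithinAt

lemma ext_linear [IsLocallyFiniteMeasure μ] (h : ExtensionSetting Ω μ c K φ ξ) (a b : ℝ)
    {g₁ g₂ : E n → ℝ} (h₁ : LocallyIntegrable g₁ μ) (h₂ : LocallyIntegrable g₂ μ) (X : E n) :
    ext Ω μ φ ξ (fun x => a * g₁ x + b * g₂ x) X =
      a * ext Ω μ φ ξ g₁ X + b * ext Ω μ φ ξ g₂ X := by
  by_cases hX : X ∈ Ω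
  · obtain ⟨F, hF, -⟩ := h.exists_finset hX
    have hX' := h.mem_ball_self hX
    rw [h.ext_eq_sum hX' hF, h.ext_eq_sum hX' hF, h.ext_eq_sum hX' hF, Finset.mul_sum,
      Finset.mul_sum, ← Finset.sum_add_distrib]
    refine Finset.sum_congr rfl fun I _ => ?_
    have hi : ∀ {g : E n → ℝ}, LocallyIntegrable g μ →
        IntegrableOn g (Metric.ball (ξ I) (side I)) μ := fun hg =>
      (hg.integrableOn_isCompact (isCompact_closedBall (ξ I) (side I))).mono_set
        Metric.ball_subset_closedBall
    have : cubeAvg μ ξ (fun x => a * g₁ x + b * g₂ x) I =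
        a * cubeAvg μ ξ g₁ I + b * cubeAvg μ ξ g₂ I := by
      simp only [cubeAvg, setAverage_eq, smul_eq_mul]
      rw [integral_add ((hi h₁).const_mul a) ((hi h₂).const_mul b), integral_const_mul,
        integral_const_mul]
      ring
    rw [this]
    ring
  · simp [h.ext_eq_zero hX]

/-- This puts `B_I` inside `B(X, 13 δ(X))`: `(31 + 1) √n side I ≤ 12 δ(X)`, plus `δ(X)/2` for the
passage to `X`. -/
lemma dist_center_le_of_mem_nearCubes (h : ExtensionSetting Ω μ c K φ ξ) {X : E n}
    {I : Dyadic n} (hI : I ∈ nearCubes Ω X) : dist (ξ I) X + side I ≤ 13 * bdDist Ω X := by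
  have h1 := side_le_of_mem_nearCubes h.doubling.nonempty hI
  have h2 := h.side_le_sqrt_mul I
  have h4 : 0 ≤ bdDist Ω X := Metric.infDist_nonneg
  obtain ⟨hI, Z, hZ, hZX⟩ := hI
  have h3 := dist_whitneyCenter_le h.dim_pos h.centers h.doubling.nonempty hI hZ
  rw [Metric.mem_ball] at hZX
  linarith [dist_triangle (ξ I) Z X]

lemma mem_frontier_of_mem_nearCubes (h : ExtensionSetting Ω μ c K φ ξ) {X : E n}
    {I : Dyadic n} (hI : I ∈ nearCubes Ω X) : ξ I ∈ frontier Ω :=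
  (h.centers I hI.1).1

/-- Comparison of `⨍_{B_I} g dμ` with any constant, by the mean oscillation on a larger ball. -/
lemma abs_cubeAvg_sub_le [IsLocallyFiniteMeasure μ] (h : ExtensionSetting Ω μ c K φ ξ)
    {g : E n → ℝ} (hg : LocallyIntegrable g μ) {I : Dyadic n} (hI : I ∈ whitney Ω) {X : E n}
    {R : ℝ} {p : ℕ} (h1 : dist (ξ I) X + side I ≤ R) (h2 : R + R ≤ 2 ^ p * side I) (a : ℝ) :
    |cubeAvg μ ξ g I - a| ≤ c ^ p * ⨍ z in Metric.ball X R, |g z - a| ∂μ := by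
  have hξ := (h.centers I hI).1
  have hs := side_pos I
  refine abs_average_sub_le (Metric.ball_subset_ball' (by linarith)) measure_ball_lt_top.ne
    (h.doubling.pos _ hξ _ hs) (h.doubling.measureReal_le_of_subset hξ hs h2 ?_)
    ((hg.integrableOn_isCompact (isCompact_closedBall X R)).mono_set Metric.ball_subset_closedBall)
    a
  refine Metric.ball_subset_ball' ?_
  rw [dist_comm]
  linarith

/-- Pointwise gradient estimate for the extension. -/
lemma norm_gradient_ext_le [IsLocallyFiniteMeasure μ] (h : ExtensionSetting Ω μ c K φ ξ)
    {g : E n → ℝ} (hg : LocallyIntegrable g μ) {X : E n} (hX : X ∈ Ω) {R : ℝ}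
    (hR : 13 * bdDist Ω X ≤ R) (hR' : R ≤ 26 * bdDist Ω X) (a : ℝ) :
    ‖gradient (ext Ω μ φ ξ g) X‖ ≤
      nearCount n * (|K| * (728 * n) * c ^ (11 + n)) * R⁻¹ *
        ⨍ z in Metric.ball X R, |g z - a| ∂μ := by
  have hδ := bdDist_pos h.isOpen h.doubling.nonempty hX
  have hc := h.doubling.one_lt
  have hRpos : 0 < R := by linarith
  obtain ⟨F, hF, hcard⟩ := h.exists_finset hX
  set O := ⨍ z in Metric.ball X R, |g z - a| ∂μ with hO
  have hO0 : 0 ≤ O := by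
    rw [hO, setAverage_eq]
    exact smul_nonneg (inv_nonneg.2 measureReal_nonneg) (integral_nonneg fun _ => abs_nonneg _)
  rw [norm_gradient]
  refine norm_fderiv_le_of_lip' ℝ (by positivity) ?_
  filter_upwards [Metric.isOpen_ball.mem_nhds (h.mem_ball_self hX)] with Y hY
  have hX' := h.mem_ball_self hX
  -- The partition sums to `1` at both points, so subtracting `a` from each average changes nothing.
  have e1 : ext Ω μ φ ξ g Y - ext Ω μ φ ξ g X =
      ∑ I ∈ F, (φ I Y - φ I X) * (cubeAvg μ ξ g I - a) := by
    have s1 := h.sum_eq_one hX hX' hF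
    have s2 := h.sum_eq_one hX hY hF
    rw [h.ext_eq_sum hX' hF, h.ext_eq_sum hY hF]
    simp only [mul_sub, sub_mul, Finset.sum_sub_distrib, ← Finset.sum_mul, s1, s2]
    ring
  rw [e1]
  refine (Finset.abs_sum_le_sum_abs _ _).trans ?_
  have key : ∀ I ∈ F, |(φ I Y - φ I X) * (cubeAvg μ ξ g I - a)| ≤
      (|K| * (728 * n) * c ^ (11 + n)) * R⁻¹ * O * ‖Y - X‖ := by
    intro I hI
    have hI' : I ∈ nearCubes Ω X := hF ▸ hI
    have hs := side_pos I
    have b1 := bdDist_le_of_mem_nearCubes h.doubling.nonempty hI'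
    have b2 : √n * side I ≤ n * side I := by gcongr; exact h.sqrt_le
    -- `728 = 26 · 28`. The exponent `11 + n` below comes from `2 · 728 ≤ 2 ^ 11` and `n ≤ 2 ^ n`.
    have b3 : R ≤ 728 * (n * side I) := by linarith
    have b4 : |K| / side I ≤ |K| * (728 * n) * R⁻¹ := by
      rw [div_eq_mul_inv, mul_assoc]
      gcongr
      rw [← div_eq_mul_inv, inv_le_comm₀ hs (div_pos (by have := h.dim_pos; positivity) hRpos),
        inv_div, div_le_iff₀ (by have := h.dim_pos; positivity)]
      linarith
    have b5 : |cubeAvg μ ξ g I - a| ≤ c ^ (11 + n) * O := by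
      refine h.abs_cubeAvg_sub_le hg hI'.1 ((h.dist_center_le_of_mem_nearCubes hI').trans hR) ?_ a
      have : (n : ℝ) ≤ 2 ^ n := by exact_mod_cast Nat.lt_two_pow_self.le
      calc R + R ≤ 2 ^ 11 * (n * side I) := by nlinarith
        _ ≤ 2 ^ 11 * (2 ^ n * side I) := by gcongr
        _ = _ := by ring
    calc |(φ I Y - φ I X) * (cubeAvg μ ξ g I - a)|
        = |φ I Y - φ I X| * |cubeAvg μ ξ g I - a| := abs_mul _ _
      _ ≤ (|K| / side I * ‖Y - X‖) * (c ^ (11 + n) * O) := by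
        gcongr
        exact h.abs_phi_sub_le hI'.1 X Y
      _ ≤ (|K| * (728 * n) * R⁻¹ * ‖Y - X‖) * (c ^ (11 + n) * O) := by gcongr
      _ = _ := by ring
  refine (Finset.sum_le_card_nsmul _ _ _ key).trans ?_
  rw [nsmul_eq_mul]
  calc (F.card : ℝ) * ((|K| * (728 * n) * c ^ (11 + n)) * R⁻¹ * O * ‖Y - X‖)
      ≤ nearCount n * ((|K| * (728 * n) * c ^ (11 + n)) * R⁻¹ * O * ‖Y - X‖) := by
        gcongr
    _ = _ := by ring

end ExtensionSetting

/-! ### The trace of the extension -/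

section Cone

variable {n : ℕ} {Ω : Set (E n)} {D : ℤ → Set (Set (E n))} {Ca : ℝ} {x X : E n}

/-- Nontangential approach: `X` is within a multiple of `2^(-k)` of the pseudocube containing `x`,
and `2^(-k) ≤ Ca side I ≤ Ca δ(X)`. -/
lemma mem_and_dist_le_of_mem_cone (hn : 0 < n) (hne : (frontier Ω).Nonempty)
    (hD : IsDyadicSystem (frontier Ω) D) (hCa : 0 < Ca) (hX : X ∈ cone Ω D Ca x) :
    X ∈ Ω ∧ dist X x ≤ (1 + 4 * Ca) * bdDist Ω X := by
  obtain ⟨k, Q, hQ, hxQ, hXQ⟩ := hX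
  simp only [whitneyRegion, mem_iUnion, mem_ofPred_eq, exists_prop] at hXQ
  obtain ⟨I, ⟨hI, hside, hdist⟩, hXI⟩ := hXQ
  have h2 : (0 : ℝ) < 2 ^ (-k) := by positivity
  -- The infimum need not be attained, so the factor `2` is relaxed to `3`.
  obtain ⟨p, hp, q, hq, hpq⟩ := exists_dist_lt_of_setDist_lt (t := 3 * 2 ^ (-k)) ⟨X, hXI⟩ ⟨x, hxQ⟩
    (hdist.trans_lt (by linarith))
  have h3 := dist_le_of_mem_cube hXI hp
  have h4 := hD.diam_le k Q hQ q hq x hxQ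
  have h5 := four_mul_side_le_bdDist hne hI (dilate_mono (by norm_num) I hXI)
  have h6 : (2 : ℝ) ^ (-k) ≤ Ca * side I := by
    rwa [inv_mul_le_iff₀ hCa] at hside
  have h7 : 1 ≤ √(n : ℝ) := Real.one_le_sqrt.2 (by exact_mod_cast hn)
  have h8 : side I ≤ √n * side I := le_mul_of_one_le_left (side_pos I).le h7
  have h9 : Ca * side I ≤ Ca * bdDist Ω X := by
    gcongr
    linarith [side_pos I]
  refine ⟨hI.1 hXI, ?_⟩
  linarith [dist_triangle4 X p q x, side_pos I]

lemma not_isBounded_of_frontier (hΩ : ¬ Bornology.IsBounded (frontier Ω)) :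
    ¬ Bornology.IsBounded Ω := fun h =>
  hΩ (h.closure.subset frontier_subset_closure)

/-- A corkscrew point at scale `2^(-k)` has a Whitney cube of side at least `2^(-k) / (14 C₁ √n)`
nearby, which `Ca ≥ 1000 C₁ √n` admits into the cone. The boundary being unbounded, corkscrew points
exist at every scale. -/
lemma exists_mem_cone {μ : Measure (E n)} {c K C₁ : ℝ} {φ : Dyadic n → E n → ℝ}
    {ξ : Dyadic n → E n} (h : ExtensionSetting Ω μ c K φ ξ)
    (hb : ¬ Bornology.IsBounded (frontier Ω)) (hD : IsDyadicSystem (frontier Ω) D)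
    (h1 : H1 Ω C₁) (hCa : 1000 * C₁ * √n ≤ Ca) (hx : x ∈ frontier Ω) (k : ℤ) :
    ∃ X ∈ cone Ω D Ca x, bdDist Ω X < 2 * 2 ^ (-k) := by
  have hr : (0 : ℝ) < 2 ^ (-k) := by positivity
  have hne := h.doubling.nonempty
  obtain ⟨hC₁, h1⟩ := h1
  obtain ⟨X, hX, hball⟩ := h1 x hx _ hr fun hbd => absurd hbd (not_isBounded_of_frontier hb)
  rw [Metric.mem_ball] at hX
  have hXΩ : X ∈ Ω := hball (Metric.mem_ball_self (by positivity))
  have hδ : C₁⁻¹ * 2 ^ (-k) ≤ bdDist Ω X := by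
    refine (Metric.le_infDist hne).2 fun y hy => ?_
    by_contra! hlt
    rw [h.isOpen.frontier_eq] at hy
    exact hy.2 (hball (by rwa [Metric.mem_ball, dist_comm]))
  -- The partition of unity supplies the cube, without proving that Whitney cubes cover `Ω`.
  obtain ⟨I, hI, hφ⟩ : ∃ I ∈ whitney Ω, φ I X ≠ 0 := by
    by_contra! hall
    have h0 : ∑' I : whitney Ω, φ I X = 0 := by simp [fun I : whitney Ω => hall I I.2]
    rw [h.partition.sum_eq, indicator_of_mem hXΩ] at h0
    exact one_ne_zero h0
  have hXI := h.partition.support_subset I hI hφ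
  have b1 := bdDist_le_mul_side hne hI hXI
  have b2 := four_mul_side_le_bdDist hne hI (dilate_mono (by norm_num) I hXI)
  have b3 : bdDist Ω X ≤ dist X x := Metric.infDist_le_dist_of_mem hx
  have b4 := dist_center_le zero_le_two hXI
  have hcI : center I ∈ cube I := center_mem_dilate zero_le_one I
  have b5 : dist (center I) x ≤ 5 / 4 * 2 ^ (-k) := by
    have := dist_triangle_left (center I) x X
    linarith
  have hsq := h.one_le_sqrt
  have hCa0 : 0 < Ca := lt_of_lt_of_le (by positivity) hCa
  obtain ⟨Q, hQ, hxQ⟩ : ∃ Q ∈ D k, x ∈ Q := by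
    have := hD.cover k ▸ hx
    exact mem_sUnion.1 this
  -- The corkscrew point is only known to lie in `2I`, whereas the cone is made of the cubes
  -- themselves; hence the center.
  refine ⟨center I, ⟨k, Q, hQ, hxQ, ?_⟩, ?_⟩
  · simp only [whitneyRegion, mem_iUnion, mem_ofPred_eq, exists_prop]
    refine ⟨I, ⟨hI, ?_, (setDist_le_dist hcI hxQ).trans (by linarith)⟩, hcI⟩
    rw [inv_mul_le_iff₀ hCa0]
    have b6 : C₁⁻¹ * 2 ^ (-k) ≤ 14 * (√n * side I) := hδ.trans b1
    rw [inv_mul_le_iff₀ hC₁] at b6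
    have hs := side_pos I
    have b7 : 1000 * C₁ * √n * side I ≤ Ca * side I := by gcongr
    have b8 : 0 ≤ C₁ * √n * side I := by positivity
    linarith
  · exact (Metric.infDist_le_dist_of_mem hx).trans_lt (by linarith)

lemma neBot_coneFilter {μ : Measure (E n)} {c K C₁ : ℝ} {φ : Dyadic n → E n → ℝ}
    {ξ : Dyadic n → E n} (h : ExtensionSetting Ω μ c K φ ξ)
    (hb : ¬ Bornology.IsBounded (frontier Ω)) (hD : IsDyadicSystem (frontier Ω) D)
    (h1 : H1 Ω C₁) (hCa : 1000 * C₁ * √n ≤ Ca) (hx : x ∈ frontier Ω) :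
    (coneFilter Ω D Ca x).NeBot := by
  rw [coneFilter, inf_principal_neBot_iff]
  intro U hU
  obtain ⟨t, ht, htU⟩ := mem_comap.1 hU
  obtain ⟨ε, hε, hεt⟩ := Metric.mem_nhds_iff.1 ht
  obtain ⟨k, hk⟩ := exists_pow_lt_of_lt_one (half_pos hε) (by norm_num : (2 : ℝ)⁻¹ < 1)
  obtain ⟨X, hX, hlt⟩ := exists_mem_cone h hb hD h1 hCa hx k
  refine ⟨X, htU (hεt ?_), hX⟩
  rw [Metric.mem_ball, Real.dist_0_eq_abs, abs_of_nonneg (show 0 ≤ bdDist Ω X from Metric.infDist_nonneg)]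
  rw [zpow_neg, zpow_natCast, ← inv_pow] at hlt
  exact hlt.trans (by linarith)

end Cone

namespace ExtensionSetting

variable {n : ℕ} {Ω : Set (E n)} {μ m : Measure (E n)} {c C₄ K : ℝ} {φ : Dyadic n → E n → ℝ}
  {ξ : Dyadic n → E n}

/-- The value of the extension is a convex combination of the averages with nonzero weight. -/
lemma abs_ext_sub_le (h : ExtensionSetting Ω μ c K φ ξ) {g : E n → ℝ} {Z : E n} (hZ : Z ∈ Ω)
    {a B : ℝ} (hB : ∀ I ∈ whitney Ω, φ I Z ≠ 0 → |cubeAvg μ ξ g I - a| ≤ B) :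
    |ext Ω μ φ ξ g Z - a| ≤ B := by
  obtain ⟨F, hF, -⟩ := h.exists_finset hZ
  have hZ' := h.mem_ball_self hZ
  have h1 := h.sum_eq_one hZ hZ' hF
  have h2 : ext Ω μ φ ξ g Z - a = ∑ I ∈ F, φ I Z * (cubeAvg μ ξ g I - a) := by
    simp only [h.ext_eq_sum hZ' hF, mul_sub, Finset.sum_sub_distrib, ← Finset.sum_mul, h1, one_mul]
  have h3 : B = ∑ I ∈ F, φ I Z * B := by rw [← Finset.sum_mul, h1, one_mul]
  rw [h2, h3]
  refine (Finset.abs_sum_le_sum_abs _ _).trans (Finset.sum_le_sum fun I hI => ?_)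
  rw [abs_mul, abs_of_nonneg (h.phi_nonneg hF Z I hI)]
  by_cases h0 : φ I Z = 0
  · simp [h0]
  · exact mul_le_mul_of_nonneg_left (hB I (show I ∈ nearCubes Ω Z from hF ▸ hI).1 h0)
      (h.phi_nonneg hF Z I hI)

lemma abs_interiorAvg_ext_sub_le [IsLocallyFiniteMeasure m] (h : ExtensionSetting Ω μ c K φ ξ)
    (hm : H4 Ω m C₄) {g : E n → ℝ} {X : E n} (hX : X ∈ Ω) {a B : ℝ}
    (hB : ∀ I ∈ nearCubes Ω X, |cubeAvg μ ξ g I - a| ≤ B) :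
    |interiorAvg Ω m (ext Ω μ φ ξ g) X - a| ≤ B := by
  have hδ := bdDist_pos h.isOpen h.doubling.nonempty hX
  have hsub : Metric.closedBall X (bdDist Ω X / 2) ⊆ Ω :=
    (Metric.closedBall_subset_ball (by linarith)).trans (ball_bdDist_subset hX)
  have hpt : ∀ Z ∈ Metric.ball X (bdDist Ω X / 2),
      ext Ω μ φ ξ g Z ∈ Metric.closedBall a B := fun Z hZ =>
    h.abs_ext_sub_le (h.mem_of_mem_ball hX hZ) fun I hI hφ => hB I (h.mem_nearCubes hI hZ hφ)
  exact (convex_closedBall a B).set_average_mem Metric.isClosed_closedBall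
    (hm.measure_pos Metric.isOpen_ball (Metric.ball_subset_closedBall.trans hsub)
      ⟨X, h.mem_ball_self hX⟩).ne' measure_ball_lt_top.ne
    ((ae_restrict_iff' measurableSet_ball).2 (Eventually.of_forall hpt))
    ((((h.continuousOn_ext g).mono hsub).integrableOn_compact (isCompact_closedBall _ _)).mono_set
      Metric.ball_subset_closedBall)

lemma tendsto_interiorAvg_ext [IsLocallyFiniteMeasure μ] [IsLocallyFiniteMeasure m]
    (h : ExtensionSetting Ω μ c K φ ξ) (hm : H4 Ω m C₄) {D : ℤ → Set (Set (E n))} {Ca : ℝ}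
    (hD : IsDyadicSystem (frontier Ω) D) (hCa : 0 < Ca) {g : E n → ℝ}
    (hg : LocallyIntegrable g μ) {x : E n}
    (hL : Tendsto (fun r => ⨍ y in Metric.closedBall x r, ‖g y - g x‖ ∂μ) (𝓝[>] 0) (𝓝 0)) :
    Tendsto (interiorAvg Ω m (ext Ω μ φ ξ g)) (coneFilter Ω D Ca x) (𝓝 (g x)) := by
  have hne := h.doubling.nonempty
  -- `B_I` lies in the closed ball of radius `(14 + 4 Ca) δ(X)` about `x`. With this `p`, that ball
  -- lies in `B(ξ_I, 2 ^ p side I)`, so the masses compare with constant `c ^ p`, independent of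
  -- `X`.
  obtain ⟨p, hp⟩ := pow_unbounded_of_one_lt (2 * (14 + 4 * Ca) * (28 * √n))
    (one_lt_two : (1 : ℝ) < 2)
  have hcone : ∀ᶠ X in coneFilter Ω D Ca x, X ∈ cone Ω D Ca x :=
    mem_inf_of_right (mem_principal_self _)
  have hδ : Tendsto (fun X => (14 + 4 * Ca) * bdDist Ω X) (coneFilter Ω D Ca x) (𝓝[>] 0) := by
    refine tendsto_nhdsWithin_iff.2 ⟨?_, ?_⟩
    · have : Tendsto (bdDist Ω) (coneFilter Ω D Ca x) (𝓝 0) := tendsto_comap.mono_left inf_le_left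
      simpa using this.const_mul (14 + 4 * Ca)
    · filter_upwards [hcone] with X hX
      exact mul_pos (by positivity)
        (bdDist_pos h.isOpen hne (mem_and_dist_le_of_mem_cone h.dim_pos hne hD hCa hX).1)
  rw [tendsto_iff_norm_sub_tendsto_zero]
  have hlim := (hL.comp hδ).const_mul (c ^ p)
  rw [mul_zero] at hlim
  refine squeeze_zero' (Eventually.of_forall fun _ => norm_nonneg _) ?_ hlim
  filter_upwards [hcone] with X hX
  obtain ⟨hXΩ, hd⟩ := mem_and_dist_le_of_mem_cone h.dim_pos hne hD hCa hX
  refine h.abs_interiorAvg_ext_sub_le hm hXΩ fun I hI => ?_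
  have hs := side_pos I
  have b1 := h.dist_center_le_of_mem_nearCubes hI
  have b2 := bdDist_le_of_mem_nearCubes hne hI
  have b3 := dist_triangle (ξ I) X x
  have hξ := h.mem_frontier_of_mem_nearCubes hI
  refine abs_average_sub_le (fun z hz => ?_) measure_closedBall_lt_top.ne
    (h.doubling.pos _ hξ _ hs)
    (h.doubling.measureReal_le_of_subset hξ hs (p := p) (R := 2 ^ p * side I) le_rfl
      fun z hz => ?_)
    (hg.integrableOn_isCompact (isCompact_closedBall _ _)) (g x)
  · rw [Metric.mem_ball] at hz
    rw [Metric.mem_closedBall]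
    linarith [dist_triangle z (ξ I) x]
  · rw [Metric.mem_closedBall] at hz
    rw [Metric.mem_ball]
    have b4 : 2 * (14 + 4 * Ca) * bdDist Ω X ≤ 2 * (14 + 4 * Ca) * (28 * (√n * side I)) := by
      gcongr
    have b5 : 2 * (14 + 4 * Ca) * (28 * √n) * side I < 2 ^ p * side I := by gcongr
    linarith [dist_triangle_right z (ξ I) x]

lemma ae_hasTraceAt_ext [IsLocallyFiniteMeasure μ] [IsLocallyFiniteMeasure m]
    (h : ExtensionSetting Ω μ c K φ ξ) (hm : H4 Ω m C₄) {D : ℤ → Set (Set (E n))} {Ca C₁ : ℝ}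
    (hb : ¬ Bornology.IsBounded (frontier Ω)) (hD : IsDyadicSystem (frontier Ω) D)
    (h1 : H1 Ω C₁) (hCa : 1000 * C₁ * √n ≤ Ca) {g : E n → ℝ} (hg : LocallyIntegrable g μ) :
    ∀ᵐ x ∂μ, HasTraceAt Ω m D Ca (ext Ω μ φ ξ g) x (g x) := by
  have hCa0 : 0 < Ca := by
    have := h1.1
    have := h.one_le_sqrt
    exact lt_of_lt_of_le (by positivity) hCa
  -- Lebesgue points along centered closed balls, for a locally finite measure on Euclidean space.
  filter_upwards [(Besicovitch.vitaliFamily μ).ae_tendsto_average_norm_sub hg, h.doubling.ae_mem]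
    with x hx hxΓ
  exact ⟨neBot_coneFilter h hb hD h1 hCa hxΓ, h.tendsto_interiorAvg_ext hm hD hCa0 hg
    (hx.comp (Besicovitch.tendsto_filterAt μ x))⟩

end ExtensionSetting

/-! ### Energy estimates -/

lemma sq_lintegral_le {α : Type*} [MeasurableSpace α] {ν : Measure α} {f : α → ℝ≥0∞}
    (hf : AEMeasurable f ν) : (∫⁻ x, f x ∂ν) ^ 2 ≤ ν univ * ∫⁻ x, f x ^ 2 ∂ν := by
  have h := ENNReal.lintegral_mul_le_Lp_mul_Lq ν Real.HolderConjugate.two_two hf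
    (aemeasurable_const (b := (1 : ℝ≥0∞)))
  simp only [Pi.mul_apply, mul_one, ENNReal.one_rpow, lintegral_const, one_mul] at h
  have h2 := pow_le_pow_left' h 2
  rw [mul_pow, ← ENNReal.rpow_natCast, ← ENNReal.rpow_natCast, ← ENNReal.rpow_natCast,
    ← ENNReal.rpow_mul, ← ENNReal.rpow_mul] at h2
  norm_num at h2
  rw [mul_comm]
  exact h2

/-! ### Mean oscillation against mean square differences. -/

section Jensen

variable {n : ℕ} {μ : Measure (E n)} {g : E n → ℝ} {U : Set (E n)}

lemma enorm_sub_setAverage_le (hg : IntegrableOn g U μ) (h0 : μ U ≠ 0) (hU : μ U ≠ ⊤) (y : E n) :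
    ‖g y - ⨍ z in U, g z ∂μ‖ₑ ≤ (μ U)⁻¹ * ∫⁻ z in U, ‖g y - g z‖ₑ ∂μ := by
  have hpos : 0 < μ.real U := ENNReal.toReal_pos h0 hU
  have h1 : g y - ⨍ z in U, g z ∂μ = (μ.real U)⁻¹ * ∫ z in U, (g y - g z) ∂μ := by
    rw [integral_sub (integrableOn_const hU : IntegrableOn (fun _ => g y) U μ) hg, setAverage_eq,
      setIntegral_const]
    simp only [smul_eq_mul]
    field_simp
  rw [h1, enorm_mul]
  refine mul_le_mul' (le_of_eq ?_) (enorm_integral_le_lintegral_enorm _)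
  rw [Real.enorm_of_nonneg (inv_nonneg.2 hpos.le), ENNReal.ofReal_inv_of_pos hpos,
    ofReal_measureReal hU]

/-- The squared mean oscillation is controlled by the mean square difference. -/
lemma sq_setAverage_abs_sub_le [SFinite μ] (hgm : Measurable g) (hg : IntegrableOn g U μ)
    (h0 : μ U ≠ 0) (hU : μ U ≠ ⊤) :
    ENNReal.ofReal (⨍ z in U, |g z - ⨍ z in U, g z ∂μ| ∂μ) ^ 2 ≤
      (μ U)⁻¹ ^ 2 * ∫⁻ y in U, ∫⁻ z in U, ‖g y - g z‖ₑ ^ 2 ∂μ ∂μ := by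
  set a := ⨍ z in U, g z ∂μ with ha
  have hpos : 0 < μ.real U := ENNReal.toReal_pos h0 hU
  have hd : Measurable fun p : E n × E n => ‖g p.1 - g p.2‖ₑ := by fun_prop
  have e1 : ENNReal.ofReal (⨍ z in U, |g z - a| ∂μ) = (μ U)⁻¹ * ∫⁻ z in U, ‖g z - a‖ₑ ∂μ := by
    rw [setAverage_eq, smul_eq_mul, ENNReal.ofReal_mul (inv_nonneg.2 hpos.le),
      ENNReal.ofReal_inv_of_pos hpos, ofReal_measureReal hU]
    congr 1
    exact ofReal_integral_norm_eq_lintegral_enorm (hg.sub (integrableOn_const hU))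
  have e2 : ∫⁻ z in U, ‖g z - a‖ₑ ∂μ ≤
      (μ U)⁻¹ * ∫⁻ y in U, ∫⁻ z in U, ‖g y - g z‖ₑ ∂μ ∂μ := by
    rw [← lintegral_const_mul' _ _ (ENNReal.inv_ne_top.2 h0)]
    exact lintegral_mono fun y => enorm_sub_setAverage_le hg h0 hU y
  have e3 : (∫⁻ y in U, ∫⁻ z in U, ‖g y - g z‖ₑ ∂μ ∂μ) ^ 2 ≤
      μ U * (μ U * ∫⁻ y in U, ∫⁻ z in U, ‖g y - g z‖ₑ ^ 2 ∂μ ∂μ) := by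
    refine (sq_lintegral_le hd.lintegral_prod_right'.aemeasurable).trans ?_
    rw [Measure.restrict_apply_univ]
    gcongr
    rw [← lintegral_const_mul' _ _ hU]
    refine lintegral_mono fun y => ?_
    refine (sq_lintegral_le (hd.comp measurable_prodMk_left).aemeasurable).trans ?_
    rw [Measure.restrict_apply_univ]
    rfl
  rw [e1]
  calc ((μ U)⁻¹ * ∫⁻ z in U, ‖g z - a‖ₑ ∂μ) ^ 2
      ≤ ((μ U)⁻¹ * ((μ U)⁻¹ * ∫⁻ y in U, ∫⁻ z in U, ‖g y - g z‖ₑ ∂μ ∂μ)) ^ 2 := by gcongr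
    _ = (μ U)⁻¹ ^ 4 * (∫⁻ y in U, ∫⁻ z in U, ‖g y - g z‖ₑ ∂μ ∂μ) ^ 2 := by ring
    _ ≤ (μ U)⁻¹ ^ 4 * (μ U * (μ U * ∫⁻ y in U, ∫⁻ z in U, ‖g y - g z‖ₑ ^ 2 ∂μ ∂μ)) := by gcongr
    _ = (μ U)⁻¹ ^ 2 * ((μ U)⁻¹ * μ U) ^ 2 * ∫⁻ y in U, ∫⁻ z in U, ‖g y - g z‖ₑ ^ 2 ∂μ ∂μ := by
        ring
    _ = _ := by rw [ENNReal.inv_mul_cancel h0 hU, one_pow, mul_one]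

end Jensen

/-! ### The kernel of the trace norm and its sum over scales. -/

section Kernel

variable {n : ℕ} {Ω : Set (E n)} {m μ : Measure (E n)} {c C₄ C₅ : ℝ} {g : E n → ℝ}

/-- The kernel `m(B(y,R) ∩ Ω) / (R² μ(B(y,R))²)`. -/
noncomputable def kern (Ω : Set (E n)) (m μ : Measure (E n)) (y : E n) (R : ℝ) : ℝ :=
  m.real (Metric.ball y R ∩ Ω) / (R ^ 2 * μ.real (Metric.ball y R) ^ 2)

lemma kern_nonneg (y : E n) (R : ℝ) : 0 ≤ kern Ω m μ y R := by
  unfold kern; positivity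

/-- Identifies the density of `‖g‖_H²` with `kern` at radius `dist x y`. If the mass of the ball
vanishes, both sides are `0` by the convention for division by zero. -/
lemma rho_sq_mul_div (y : E n) (R t : ℝ) :
    rho Ω m μ y R ^ 2 * t / m.real (Metric.ball y R ∩ Ω) = kern Ω m μ y R * t := by
  unfold rho kern
  by_cases h : m.real (Metric.ball y R ∩ Ω) = 0
  · simp [h]
  · rw [div_pow, mul_pow, div_mul_eq_mul_div, div_div, mul_comm (_ ^ 2 * _) (m.real _), pow_two,
      mul_assoc, mul_div_mul_left _ _ h, div_mul_eq_mul_div]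

lemma measureReal_ball_inter_pos [IsLocallyFiniteMeasure m] (hΩ : IsOpen Ω) (hm : H4 Ω m C₄)
    {y : E n} (hy : y ∈ frontier Ω) {r : ℝ} (hr : 0 < r) :
    0 < m.real (Metric.ball y r ∩ Ω) := by
  refine ENNReal.toReal_pos (hm.measure_pos (Metric.isOpen_ball.inter hΩ) inter_subset_right ?_).ne'
    (measure_ne_top_of_subset inter_subset_left measure_ball_lt_top.ne)
  exact mem_closure_iff.1 (frontier_subset_closure hy) _ Metric.isOpen_ball
    (Metric.mem_ball_self hr)

/-- Since `kern = ρ / (R μ)`, the growth `(R/s)^(1 - 1/C₅)` allowed for `ρ` by (H5) is beaten by the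
factor `1/R`, leaving the decay `(s/R)^(1/C₅)`. In the remaining range `R ≤ s < 2R`, monotonicity of
`m` and one doubling of `μ` give the constant `4 c²`. -/
lemma kern_le [IsLocallyFiniteMeasure m] [IsLocallyFiniteMeasure μ] (hΩ : IsOpen Ω)
    (hμ : IsDoublingOn (frontier Ω) μ c) (hm : H4 Ω m C₄) (h5 : H5 Ω m μ C₅) {y : E n}
    (hy : y ∈ frontier Ω) {s R : ℝ} (hs : 0 < s) (hsR : s < 2 * R) :
    kern Ω m μ y R ≤ max C₅ (4 * c ^ 2) * (s / R) ^ C₅⁻¹ * kern Ω m μ y s := by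
  have hR : 0 < R := by linarith
  have hk := kern_nonneg (Ω := Ω) (m := m) (μ := μ) y s
  obtain ⟨hC₅, h5⟩ := h5
  have hμs := hμ.pos y hy s hs
  have hms := measureReal_ball_inter_pos hΩ hm hy hs
  rcases lt_or_ge s R with hlt | hge
  · have h1 := h5 y hy s R hs hlt
    have hρ : 0 < rho Ω m μ y s := div_pos hms (by positivity)
    rw [div_le_iff₀ hρ] at h1
    have h2 : kern Ω m μ y R = rho Ω m μ y R / (R * μ.real (Metric.ball y R)) := by
      unfold kern rho
      rw [div_div]
      ring_nf
    have h3 : kern Ω m μ y s = rho Ω m μ y s / (s * μ.real (Metric.ball y s)) := by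
      unfold kern rho
      rw [div_div]
      ring_nf
    have h4 : μ.real (Metric.ball y s) ≤ μ.real (Metric.ball y R) :=
      measureReal_mono (Metric.ball_subset_ball hlt.le) measure_ball_lt_top.ne
    have h6 : (R / s) ^ (1 - C₅⁻¹) / R = (s / R) ^ C₅⁻¹ / s := by
      rw [Real.rpow_sub (div_pos hR hs), Real.rpow_one, ← inv_div R s,
        Real.inv_rpow (div_pos hR hs).le]
      field_simp
    calc kern Ω m μ y R
        ≤ (C₅ * (R / s) ^ (1 - C₅⁻¹) * rho Ω m μ y s) / (R * μ.real (Metric.ball y R)) := by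
          rw [h2]; gcongr
      _ = C₅ * ((R / s) ^ (1 - C₅⁻¹) / R) * rho Ω m μ y s / μ.real (Metric.ball y R) := by
          field_simp
      _ ≤ C₅ * ((R / s) ^ (1 - C₅⁻¹) / R) * rho Ω m μ y s / μ.real (Metric.ball y s) := by
          gcongr
      _ = C₅ * (s / R) ^ C₅⁻¹ * kern Ω m μ y s := by
          rw [h6, h3]; field_simp
      _ ≤ _ := by gcongr; exact le_max_left _ _
  · have h1 : m.real (Metric.ball y R ∩ Ω) ≤ m.real (Metric.ball y s ∩ Ω) :=
      measureReal_mono (inter_subset_inter_left _ (Metric.ball_subset_ball hge))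
        (measure_ne_top_of_subset inter_subset_left measure_ball_lt_top.ne)
    have h2 : μ.real (Metric.ball y s) ≤ c * μ.real (Metric.ball y R) :=
      (measureReal_mono (Metric.ball_subset_ball hsR.le) measure_ball_lt_top.ne).trans
        (hμ.doubling y hy R hR)
    have hμR := hμ.pos y hy R hR
    have hc := hμ.one_lt
    have h3 : s ^ 2 * μ.real (Metric.ball y s) ^ 2 ≤
        4 * c ^ 2 * (R ^ 2 * μ.real (Metric.ball y R) ^ 2) := by
      calc s ^ 2 * μ.real (Metric.ball y s) ^ 2
          ≤ (2 * R) ^ 2 * (c * μ.real (Metric.ball y R)) ^ 2 := by gcongr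
        _ = _ := by ring
    have h4 : kern Ω m μ y R ≤ 4 * c ^ 2 * kern Ω m μ y s := by
      unfold kern
      rw [← mul_div_assoc, div_le_div_iff₀ (by positivity) (by positivity)]
      calc _ ≤ m.real (Metric.ball y s ∩ Ω) *
            (4 * c ^ 2 * (R ^ 2 * μ.real (Metric.ball y R) ^ 2)) := by gcongr
        _ = _ := by ring
    have h6 : 1 ≤ (s / R) ^ C₅⁻¹ :=
      Real.one_le_rpow ((one_le_div hR).2 hge) (inv_nonneg.2 hC₅.le)
    calc kern Ω m μ y R ≤ (4 * c ^ 2) * 1 * kern Ω m μ y s := by rw [mul_one]; exact h4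
      _ ≤ _ := by
        gcongr
        exact le_max_right _ _

/-- If `2^i ≤ s/b < 2^(i+1)`, the condition on `j` forces `j ≥ i`, and the term of index `i + t` is
at most `(2 · 2^(-t))^ε`. -/
lemma tsum_geometric_scales_le {ε b s : ℝ} (hε : 0 < ε) (hb : 0 < b) (hs : 0 < s) :
    ∑' j : ℤ, (if s < 2 * (b * 2 ^ j) then ENNReal.ofReal ((s / (b * 2 ^ j)) ^ ε) else 0) ≤
      ENNReal.ofReal (2 ^ ε * (1 - 2 ^ (-ε))⁻¹) := by
  obtain ⟨i, hi1, hi2⟩ := exists_mem_Ico_zpow (div_pos hs hb) (one_lt_two : (1 : ℝ) < 2)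
  have hcond : ∀ j : ℤ, s < 2 * (b * 2 ^ j) → i ≤ j := fun j hj => by
    have h1 : (2 : ℝ) ^ i < 2 ^ (j + 1) := by
      refine hi1.trans_lt ?_
      rw [div_lt_iff₀ hb, zpow_add_one₀ two_ne_zero]
      linarith
    rw [zpow_lt_zpow_iff_right₀ one_lt_two] at h1
    omega
  have hinj : Function.Injective fun t : ℕ => i + (t : ℤ) := fun a b h => by simpa using h
  rw [← hinj.tsum_eq]
  · have hr : (2 : ℝ) ^ (-ε) < 1 := Real.rpow_lt_one_of_one_lt_of_neg one_lt_two (neg_lt_zero.2 hε)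
    rw [← tsum_geometric_of_lt_one (by positivity) hr, ← tsum_mul_left,
      ENNReal.ofReal_tsum_of_nonneg (fun t => by positivity)
        ((summable_geometric_of_lt_one (by positivity) hr).mul_left _)]
    refine ENNReal.tsum_le_tsum fun t => ?_
    split_ifs
    · refine ENNReal.ofReal_le_ofReal ?_
      have h1 : s / (b * 2 ^ (i + (t : ℤ))) ≤ 2 * (2 ^ t)⁻¹ := by
        rw [← div_div, div_le_iff₀ (by positivity)]
        refine hi2.le.trans (le_of_eq ?_)
        rw [zpow_add₀ two_ne_zero, zpow_add₀ two_ne_zero, zpow_natCast]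
        field_simp
      calc (s / (b * 2 ^ (i + (t : ℤ)))) ^ ε ≤ (2 * (2 ^ t)⁻¹) ^ ε := by gcongr
        _ = 2 ^ ε * (2 ^ (-ε)) ^ t := by
          rw [Real.mul_rpow (by positivity) (by positivity), Real.inv_rpow (by positivity),
            ← Real.rpow_natCast, ← Real.rpow_natCast, ← Real.rpow_mul (by positivity),
            ← Real.rpow_mul (by positivity), ← Real.rpow_neg (by positivity)]
          ring_nf
    · exact zero_le
  · intro j hj
    have : s < 2 * (b * 2 ^ j) := by
      by_contra h
      simp [h] at hj
    exact ⟨(j - i).toNat, by simp [hcond j this]⟩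

lemma measurable_measureReal_ball [SFinite μ] (R : ℝ) :
    Measurable fun y : E n => μ.real (Metric.ball y R) := by
  have hs : MeasurableSet {p : E n × E n | dist p.2 p.1 < R} :=
    measurableSet_lt (by fun_prop) measurable_const
  exact (measurable_measure_prodMk_left hs).ennreal_toReal

lemma measurable_kern [SFinite m] [SFinite μ] (hΩ : IsOpen Ω) (R : ℝ) :
    Measurable fun y : E n => kern Ω m μ y R := by
  unfold kern
  have h1 : (fun y : E n => m.real (Metric.ball y R ∩ Ω)) =
      fun y => (m.restrict Ω).real (Metric.ball y R) := by
    ext y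
    rw [measureReal_restrict_apply' hΩ.measurableSet]
  refine Measurable.div ?_ (measurable_const.mul ((measurable_measureReal_ball R).pow_const 2))
  rw [h1]
  exact measurable_measureReal_ball R

/-- The energy of `g` at scale `R`. -/
noncomputable def scaleEnergy (Ω : Set (E n)) (m μ : Measure (E n)) (g : E n → ℝ) (R : ℝ) :
    ℝ≥0∞ :=
  ∫⁻ y, ∫⁻ z, (if dist y z < 2 * R then ENNReal.ofReal (kern Ω m μ y R * |g y - g z| ^ 2) else 0)
    ∂μ ∂μ

lemma measurable_scaleEnergy_integrand [SFinite m] [SFinite μ] (hΩ : IsOpen Ω) (hg : Measurable g)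
    (R : ℝ) : Measurable fun p : E n × E n =>
      if dist p.1 p.2 < 2 * R then ENNReal.ofReal (kern Ω m μ p.1 R * |g p.1 - g p.2| ^ 2)
      else 0 := by
  have := measurable_kern (m := m) (μ := μ) hΩ R
  refine Measurable.ite (measurableSet_lt (by fun_prop) measurable_const) ?_ measurable_const
  have h2 : Measurable fun p : E n × E n => |g p.1 - g p.2| ^ 2 :=
    (((hg.comp measurable_fst).sub (hg.comp measurable_snd)).abs).pow_const 2
  exact ((this.comp measurable_fst).mul h2).ennreal_ofReal

/-- The constant in the bound of the energies at all scales by `‖g‖_H²`. -/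
noncomputable def scaleConst (c C₅ : ℝ) : ℝ :=
  max C₅ (4 * c ^ 2) * (2 ^ C₅⁻¹ * (1 - 2 ^ (-C₅⁻¹))⁻¹)

/-- Tonelli moves the sum under both integrals. For a fixed pair only scales `R > |y - z| / 2`
contribute, and `kern_le` makes them geometric. -/
lemma tsum_scaleEnergy_le [IsLocallyFiniteMeasure m] [IsLocallyFiniteMeasure μ] (hΩ : IsOpen Ω)
    (hμ : IsDoublingOn (frontier Ω) μ c) (hm : H4 Ω m C₄) (h5 : H5 Ω m μ C₅)
    (hg : Measurable g) {b : ℝ} (hb : 0 < b) :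
    ∑' j : ℤ, scaleEnergy Ω m μ g (b * 2 ^ j) ≤
      ENNReal.ofReal (scaleConst c C₅) * hEnergy Ω m μ g := by
  have hmeas := fun R => measurable_scaleEnergy_integrand (m := m) (μ := μ) hΩ hg R
  unfold scaleEnergy hEnergy
  rw [← lintegral_tsum fun j => (hmeas _).lintegral_prod_right'.aemeasurable,
    ← lintegral_const_mul' _ _ ENNReal.ofReal_ne_top]
  refine lintegral_mono_ae ?_
  filter_upwards [hμ.ae_mem] with y hy
  rw [← lintegral_tsum (f := fun (j : ℤ) z => if dist y z < 2 * (b * 2 ^ j) then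
        ENNReal.ofReal (kern Ω m μ y (b * 2 ^ j) * |g y - g z| ^ 2) else 0)
      fun j => ((hmeas (b * 2 ^ j)).comp measurable_prodMk_left).aemeasurable,
    ← lintegral_const_mul' _ _ ENNReal.ofReal_ne_top]
  refine lintegral_mono fun z => ?_
  rcases eq_or_ne y z with rfl | hyz
  · simp
  have hs : 0 < dist y z := dist_pos.2 hyz
  set s := dist y z
  have hk := kern_nonneg (Ω := Ω) (m := m) (μ := μ) y s
  have hmax : 0 ≤ max C₅ (4 * c ^ 2) := h5.1.le.trans (le_max_left _ _)
  rw [rho_sq_mul_div]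
  calc ∑' j : ℤ, (if s < 2 * (b * 2 ^ j) then
          ENNReal.ofReal (kern Ω m μ y (b * 2 ^ j) * |g y - g z| ^ 2) else 0)
      ≤ ∑' j : ℤ, ENNReal.ofReal (max C₅ (4 * c ^ 2) * (kern Ω m μ y s * |g y - g z| ^ 2)) *
          (if s < 2 * (b * 2 ^ j) then ENNReal.ofReal ((s / (b * 2 ^ j)) ^ C₅⁻¹) else 0) := by
        refine ENNReal.tsum_le_tsum fun j => ?_
        split_ifs with hlt
        · rw [← ENNReal.ofReal_mul (by positivity)]
          refine ENNReal.ofReal_le_ofReal ?_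
          calc _ ≤ max C₅ (4 * c ^ 2) * (s / (b * 2 ^ j)) ^ C₅⁻¹ * kern Ω m μ y s *
                |g y - g z| ^ 2 := by
                gcongr
                exact kern_le hΩ hμ hm h5 hy hs hlt
            _ = _ := by ring
        · simp
    _ ≤ ENNReal.ofReal (max C₅ (4 * c ^ 2) * (kern Ω m μ y s * |g y - g z| ^ 2)) *
          ENNReal.ofReal (2 ^ C₅⁻¹ * (1 - 2 ^ (-C₅⁻¹))⁻¹) := by
        rw [ENNReal.tsum_mul_left]
        gcongr
        exact tsum_geometric_scales_le (inv_pos.2 h5.1) hb hs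
    _ = _ := by
        rw [ENNReal.ofReal_mul hmax, scaleConst, ENNReal.ofReal_mul hmax]
        ring

/-- Doubling is available only at boundary centers. With `x` in the boundary and `|X - x| < R/2`,
one has `B(y,R) ⊆ B(x, 2³ · R/2)` and `B(x, R/2) ⊆ B(X,R)`. -/
lemma measureReal_ball_le_of_near [IsLocallyFiniteMeasure μ] (hμ : IsDoublingOn (frontier Ω) μ c)
    {X y : E n} {R : ℝ} (hX : bdDist Ω X < R / 2) (hy : dist y X < R) :
    μ.real (Metric.ball y R) ≤ c ^ 3 * μ.real (Metric.ball X R) := by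
  obtain ⟨x, hx, hd⟩ := exists_mem_frontier_dist_lt hμ.nonempty hX
  have hR : 0 < R / 2 := dist_nonneg.trans_lt hd
  have hc := hμ.one_lt
  refine (hμ.measureReal_le_of_subset hx hR (p := 3) (R := 4 * R) (by linarith)
    (Metric.ball_subset_ball' ?_)).trans ?_
  · linarith [dist_triangle y X x]
  · gcongr
    · exact measure_ball_lt_top.ne
    · refine Metric.ball_subset_ball' ?_
      rw [dist_comm]
      linarith

lemma measureReal_ball_pos_of_near [IsLocallyFiniteMeasure μ]
    (hμ : IsDoublingOn (frontier Ω) μ c) {X : E n} {R : ℝ} (hX : bdDist Ω X < R) :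
    0 < μ.real (Metric.ball X R) := by
  obtain ⟨x, hx, hd⟩ := exists_mem_frontier_dist_lt hμ.nonempty hX
  refine (hμ.pos x hx (R - dist X x) (by linarith)).trans_le
    (measureReal_mono (Metric.ball_subset_ball' ?_) measure_ball_lt_top.ne)
  rw [dist_comm]
  linarith

/-- Integration of mean square differences over a set of points at distance `≲ R` from the
boundary. -/
lemma lintegral_meanSquare_le [IsLocallyFiniteMeasure m] [IsLocallyFiniteMeasure μ]
    (hμ : IsDoublingOn (frontier Ω) μ c) (hg : Measurable g) {R : ℝ} (hR : 0 < R)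
    {T : Set (E n)} (hT : MeasurableSet T) (hTΩ : T ⊆ Ω) (hTR : ∀ X ∈ T, bdDist Ω X < R / 2) :
    ∫⁻ X in T, ENNReal.ofReal R⁻¹ ^ 2 * ((μ (Metric.ball X R))⁻¹ ^ 2 *
        ∫⁻ y in Metric.ball X R, ∫⁻ z in Metric.ball X R, ‖g y - g z‖ₑ ^ 2 ∂μ ∂μ) ∂m ≤
      ENNReal.ofReal (c ^ 6) * scaleEnergy Ω m μ g R := by
  classical
  have hc := hμ.one_lt
  -- Replacing `μ(B(X,R))^(-2)` by `c^6 μ(B(y,R))^(-2)` frees the weight from `X`. After exchanging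
  -- integrals, `X` enters only through `|X - y| < R`.
  let w : E n → ℝ := fun y => c ^ 6 / (R ^ 2 * μ.real (Metric.ball y R) ^ 2)
  have hw : Measurable w :=
    measurable_const.div (measurable_const.mul ((measurable_measureReal_ball R).pow_const 2))
  let f : E n → E n → ℝ≥0∞ := fun y z =>
    if dist y z < 2 * R then ENNReal.ofReal (w y * |g y - g z| ^ 2) else 0
  have hf : Measurable (Function.uncurry f) := by
    refine Measurable.ite (measurableSet_lt (by fun_prop) measurable_const) ?_ measurable_const
    have h2 : Measurable fun p : E n × E n => |g p.1 - g p.2| ^ 2 :=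
      (((hg.comp measurable_fst).sub (hg.comp measurable_snd)).abs).pow_const 2
    exact ((hw.comp measurable_fst).mul h2).ennreal_ofReal
  let W : E n → ℝ≥0∞ := fun y => ∫⁻ z, f y z ∂μ
  have hW : Measurable W := hf.lintegral_prod_right'
  let J : E n → E n → ℝ≥0∞ := fun X y => if dist y X < R then W y else 0
  have hJ : Measurable (Function.uncurry J) :=
    Measurable.ite (measurableSet_lt (by fun_prop) measurable_const) (hW.comp measurable_snd)
      measurable_const
  have step1 : ∀ X ∈ T, ENNReal.ofReal R⁻¹ ^ 2 * ((μ (Metric.ball X R))⁻¹ ^ 2 *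
      ∫⁻ y in Metric.ball X R, ∫⁻ z in Metric.ball X R, ‖g y - g z‖ₑ ^ 2 ∂μ ∂μ) ≤
      ∫⁻ y, J X y ∂μ := by
    intro X hX
    have hμX := measureReal_ball_pos_of_near hμ ((hTR X hX).trans (half_lt_self hR))
    have hμX' : μ (Metric.ball X R) ≠ 0 := fun h => by simp [Measure.real, h] at hμX
    have hcoef : ENNReal.ofReal R⁻¹ ^ 2 * (μ (Metric.ball X R))⁻¹ ^ 2 =
        ENNReal.ofReal ((R ^ 2 * μ.real (Metric.ball X R) ^ 2)⁻¹) := by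
      rw [← ofReal_measureReal (measure_ball_lt_top.ne : μ (Metric.ball X R) ≠ ⊤),
        ← ENNReal.ofReal_inv_of_pos hμX, ← ENNReal.ofReal_pow (by positivity),
        ← ENNReal.ofReal_pow (by positivity), ← ENNReal.ofReal_mul (by positivity)]
      congr 1
      rw [mul_inv, inv_pow, inv_pow]
    rw [← mul_assoc, hcoef, ← lintegral_const_mul' _ _ ENNReal.ofReal_ne_top,
      ← lintegral_indicator measurableSet_ball]
    refine lintegral_mono_ae ?_
    filter_upwards [hμ.ae_mem] with y hy
    by_cases hyX : dist y X < R
    · rw [indicator_of_mem (Metric.mem_ball.2 hyX)]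
      simp only [J, hyX, if_true, W]
      rw [← lintegral_const_mul' _ _ ENNReal.ofReal_ne_top, ← lintegral_indicator measurableSet_ball]
      refine lintegral_mono fun z => ?_
      by_cases hzX : dist z X < R
      · rw [indicator_of_mem (Metric.mem_ball.2 hzX)]
        have hyz : dist y z < 2 * R := by linarith [dist_triangle_right y z X]
        have hμy := hμ.pos y hy R hR
        simp only [f, hyz, if_true, w]
        rw [Real.enorm_eq_ofReal_abs, ← ENNReal.ofReal_pow (abs_nonneg _),
          ← ENNReal.ofReal_mul (by positivity)]
        refine ENNReal.ofReal_le_ofReal ?_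
        refine mul_le_mul_of_nonneg_right ?_ (by positivity)
        rw [inv_le_comm₀ (by positivity) (by positivity), inv_div, div_le_iff₀ (by positivity)]
        calc R ^ 2 * μ.real (Metric.ball y R) ^ 2
            ≤ R ^ 2 * (c ^ 3 * μ.real (Metric.ball X R)) ^ 2 := by
              gcongr
              exact measureReal_ball_le_of_near hμ (hTR X hX) hyX
          _ = _ := by ring
      · rw [indicator_of_notMem (by simpa using hzX)]
        exact zero_le
    · rw [indicator_of_notMem (by simpa using hyX)]
      exact zero_le
  calc _ ≤ ∫⁻ X in T, ∫⁻ y, J X y ∂μ ∂m := setLIntegral_mono' hT step1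
    _ = ∫⁻ y, ∫⁻ X in T, J X y ∂m ∂μ := lintegral_lintegral_swap hJ.aemeasurable
    _ ≤ ∫⁻ y, ENNReal.ofReal (c ^ 6) * ∫⁻ z, (if dist y z < 2 * R then
          ENNReal.ofReal (kern Ω m μ y R * |g y - g z| ^ 2) else 0) ∂μ ∂μ := by
        refine lintegral_mono fun y => ?_
        have e1 : ∀ X, J X y = (Metric.ball y R).indicator (fun _ => W y) X := fun X => by
          simp only [J, indicator, Metric.mem_ball, dist_comm]
        -- Integrating out `X` supplies the numerator of `kern`.
        have e2 : ∫⁻ X in T, J X y ∂m ≤ W y * m (Metric.ball y R ∩ Ω) := by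
          simp only [e1]
          rw [lintegral_indicator measurableSet_ball, setLIntegral_const,
            Measure.restrict_apply measurableSet_ball]
          gcongr
        refine e2.trans ?_
        rw [← ofReal_measureReal (measure_ne_top_of_subset inter_subset_left
          measure_ball_lt_top.ne : m (Metric.ball y R ∩ Ω) ≠ ⊤)]
        simp only [W]
        rw [← lintegral_mul_const' _ _ ENNReal.ofReal_ne_top,
          ← lintegral_const_mul' _ _ ENNReal.ofReal_ne_top]
        refine lintegral_mono fun z => ?_
        simp only [f]
        split_ifs
        · rw [← ENNReal.ofReal_mul (by positivity), ← ENNReal.ofReal_mul (by positivity)]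
          refine ENNReal.ofReal_le_ofReal (le_of_eq ?_)
          simp only [w, kern]
          ring
        · simp
    _ = _ := lintegral_const_mul' _ _ ENNReal.ofReal_ne_top

/-- Square integrals of functions dominated by mean oscillations at scale `R`. -/
lemma lintegral_sq_le_scaleEnergy [IsLocallyFiniteMeasure m] [IsLocallyFiniteMeasure μ]
    (hμ : IsDoublingOn (frontier Ω) μ c) (hg : Measurable g)
    (hgi : LocallyIntegrable g μ) {R : ℝ} (hR : 0 < R) {T : Set (E n)} (hT : MeasurableSet T)
    (hTΩ : T ⊆ Ω) (hTR : ∀ X ∈ T, bdDist Ω X < R / 2) {V : E n → E n} {A : ℝ} (hA : 0 ≤ A)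
    (hV : ∀ X ∈ T, ‖V X‖ ≤ A * R⁻¹ *
      ⨍ z in Metric.ball X R, |g z - ⨍ z in Metric.ball X R, g z ∂μ| ∂μ) :
    ∫⁻ X in T, ‖V X‖ₑ ^ 2 ∂m ≤ ENNReal.ofReal (A ^ 2 * c ^ 6) * scaleEnergy Ω m μ g R := by
  have hc := hμ.one_lt
  rw [ENNReal.ofReal_mul (by positivity), mul_assoc]
  refine le_trans ?_ (mul_le_mul_right (lintegral_meanSquare_le hμ hg hR hT hTΩ hTR)
    (ENNReal.ofReal (A ^ 2)))
  rw [← lintegral_const_mul' _ _ ENNReal.ofReal_ne_top]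
  refine setLIntegral_mono' hT fun X hX => ?_
  have hμX := measureReal_ball_pos_of_near hμ ((hTR X hX).trans (by linarith : R / 2 < R))
  have hμX' : μ (Metric.ball X R) ≠ 0 := fun h => by simp [Measure.real, h] at hμX
  have h1 := sq_setAverage_abs_sub_le hg
    ((hgi.integrableOn_isCompact (isCompact_closedBall X R)).mono_set
      Metric.ball_subset_closedBall) hμX' measure_ball_lt_top.ne
  have h2 : ‖V X‖ₑ ≤ ENNReal.ofReal A * ENNReal.ofReal R⁻¹ * ENNReal.ofReal
      (⨍ z in Metric.ball X R, |g z - ⨍ z in Metric.ball X R, g z ∂μ| ∂μ) := by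
    rw [← ofReal_norm, ← ENNReal.ofReal_mul hA, ← ENNReal.ofReal_mul (by positivity)]
    exact ENNReal.ofReal_le_ofReal (hV X hX)
  calc ‖V X‖ₑ ^ 2 ≤ _ := pow_le_pow_left' h2 2
    _ = ENNReal.ofReal (A ^ 2) * (ENNReal.ofReal R⁻¹ ^ 2 * ENNReal.ofReal
      (⨍ z in Metric.ball X R, |g z - ⨍ z in Metric.ball X R, g z ∂μ| ∂μ) ^ 2) := by
        rw [ENNReal.ofReal_pow hA]; ring
    _ ≤ _ := by gcongr

end Kernel

/-! ### Local integrability of the elements of `H` -/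

section TraceSpace

variable {n : ℕ} {Ω : Set (E n)} {m μ : Measure (E n)} {c C₄ C₅ : ℝ} {g : E n → ℝ}

lemma exists_lintegral_lt_top (hμ : IsDoublingOn (frontier Ω) μ c) {f : E n → ℝ≥0∞}
    (hf : ∫⁻ x, f x ∂μ < ⊤) : ∃ x ∈ frontier Ω, f x < ⊤ := by
  by_contra! h
  obtain ⟨x, hx⟩ := hμ.nonempty
  have h0 : μ univ ≠ 0 := fun h0 => by
    have := hμ.pos x hx 1 one_pos
    rw [Measure.real, measure_mono_null (subset_univ _) h0] at this
    simp at this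
  have h1 : ∫⁻ x, f x ∂μ = ∫⁻ _, ⊤ ∂μ := lintegral_congr_ae <| by
    filter_upwards [hμ.ae_mem] with y hy
    exact top_le_iff.1 (h y hy)
  rw [h1, lintegral_const, ENNReal.top_mul h0] at hf
  exact lt_irrefl _ hf

/-- The inner integral is finite at some boundary point `x`. By `kern_le` its kernel is bounded
below on `B(x,R)` by a multiple of `kern x R > 0`, so `g - g x` is square integrable on every such
ball, which has finite mass. -/
lemma MemH.locallyIntegrable [IsLocallyFiniteMeasure m] [IsLocallyFiniteMeasure μ]
    (hΩ : IsOpen Ω) (hμ : IsDoublingOn (frontier Ω) μ c) (hm : H4 Ω m C₄) (h5 : H5 Ω m μ C₅)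
    (hg : MemH Ω m μ g) : LocallyIntegrable g μ := by
  obtain ⟨hgm, hfin⟩ := hg
  obtain ⟨x, hx, hxfin⟩ := exists_lintegral_lt_top hμ hfin
  have key : ∀ R : ℝ, 0 < R → IntegrableOn g (Metric.ball x R) μ := by
    intro R hR
    have hkpos : 0 < kern Ω m μ x R :=
      div_pos (measureReal_ball_inter_pos hΩ hm hx hR)
        (mul_pos (by positivity) (pow_pos (hμ.pos x hx R hR) 2))
    have hC : 0 ≤ max C₅ (4 * c ^ 2) := h5.1.le.trans (le_max_left _ _)
    have h1 : ENNReal.ofReal (kern Ω m μ x R) * ∫⁻ z in Metric.ball x R, ‖g z - g x‖ₑ ^ 2 ∂μ ≤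
        ENNReal.ofReal (max C₅ (4 * c ^ 2)) * ∫⁻ z, ENNReal.ofReal
          (rho Ω m μ x (dist x z) ^ 2 * |g x - g z| ^ 2 /
            m.real (Metric.ball x (dist x z) ∩ Ω)) ∂μ := by
      rw [← lintegral_const_mul' _ _ ENNReal.ofReal_ne_top,
        ← lintegral_const_mul' _ _ ENNReal.ofReal_ne_top]
      refine le_trans (setLIntegral_mono' measurableSet_ball fun z hz => ?_)
        (setLIntegral_le_lintegral (Metric.ball x R) _)
      rcases eq_or_ne x z with rfl | hxz
      · simp
      rw [rho_sq_mul_div, Real.enorm_eq_ofReal_abs, ← ENNReal.ofReal_pow (abs_nonneg _),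
        ← ENNReal.ofReal_mul hkpos.le, ← ENNReal.ofReal_mul hC, abs_sub_comm (g z)]
      refine ENNReal.ofReal_le_ofReal ?_
      rw [← mul_assoc]
      refine mul_le_mul_of_nonneg_right ?_ (by positivity)
      have hs : 0 < dist x z := dist_pos.2 hxz
      rw [Metric.mem_ball, dist_comm] at hz
      refine (kern_le hΩ hμ hm h5 hx hs (by linarith : dist x z < 2 * R)).trans ?_
      have h2 : (dist x z / R) ^ C₅⁻¹ ≤ 1 :=
        Real.rpow_le_one (by positivity) ((div_le_one hR).2 hz.le) (inv_nonneg.2 h5.1.le)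
      have := kern_nonneg (Ω := Ω) (m := m) (μ := μ) x (dist x z)
      calc _ ≤ max C₅ (4 * c ^ 2) * 1 * kern Ω m μ x (dist x z) := by gcongr
        _ = _ := by ring
    have h2 : ∫⁻ z in Metric.ball x R, ‖g z - g x‖ₑ ^ 2 ∂μ < ⊤ := by
      by_contra h
      rw [not_lt, top_le_iff] at h
      rw [h, ENNReal.mul_top (by simpa using hkpos)] at h1
      exact (h1.trans_lt (ENNReal.mul_lt_top ENNReal.ofReal_lt_top hxfin)).ne rfl
    have := isFiniteMeasure_restrict.2 (measure_ball_lt_top (μ := μ) (x := x) (r := R)).ne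
    have h3 : MemLp (fun z => g z - g x) 2 (μ.restrict (Metric.ball x R)) := by
      refine ⟨(hgm.sub_const _).aestronglyMeasurable.restrict, ?_⟩
      rw [eLpNorm_lt_top_iff_lintegral_rpow_enorm_lt_top two_ne_zero ENNReal.ofNat_ne_top]
      simpa using h2
    have h4 := (h3.integrable one_le_two).add (integrable_const (g x))
    exact h4.congr (Eventually.of_forall fun z => by simp)
  intro X
  refine ⟨Metric.ball X 1, Metric.ball_mem_nhds X one_pos, (key (1 + dist X x) (by positivity)).mono_set
    (Metric.ball_subset_ball' le_rfl)⟩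

end TraceSpace

/-! ### Energy of the extension -/

/-- The constant in the pointwise gradient estimate for the extension. -/
noncomputable def gradConst (n : ℕ) (c K : ℝ) : ℝ :=
  nearCount n * (|K| * (728 * n) * c ^ (11 + n))

/-- On the layer `2^j ≤ δ < 2^(j+1)` the single radius `R = 26 · 2^j` satisfies `13 δ ≤ R ≤ 26 δ`
and `δ < R/2`, so the pointwise gradient bound and the scale estimate apply together. -/
lemma ExtensionSetting.lintegral_gradient_ext_le {n : ℕ} {Ω : Set (E n)} {m μ : Measure (E n)}
    {c C₄ C₅ K : ℝ} {φ : Dyadic n → E n → ℝ} {ξ : Dyadic n → E n} {g : E n → ℝ}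
    [IsLocallyFiniteMeasure m] [IsLocallyFiniteMeasure μ] (h : ExtensionSetting Ω μ c K φ ξ)
    (hm : H4 Ω m C₄) (h5 : H5 Ω m μ C₅) (hg : Measurable g) (hgi : LocallyIntegrable g μ) :
    ∫⁻ X in Ω, ‖gradient (ext Ω μ φ ξ g) X‖ₑ ^ 2 ∂m ≤
      ENNReal.ofReal (gradConst n c K ^ 2 * c ^ 6 * scaleConst c C₅) * hEnergy Ω m μ g := by
  have hc := h.doubling.one_lt
  let S : ℤ → Set (E n) := fun j => Ω ∩ bdDist Ω ⁻¹' Ico (2 ^ j) (2 ^ (j + 1))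
  have hSm : ∀ j, MeasurableSet (S j) := fun j =>
    h.isOpen.measurableSet.inter ((continuous_bdDist Ω).measurable measurableSet_Ico)
  have hcov : Ω ⊆ ⋃ j, S j := fun X hX => by
    obtain ⟨j, hj⟩ := exists_mem_Ico_zpow (bdDist_pos h.isOpen h.doubling.nonempty hX)
      (one_lt_two : (1 : ℝ) < 2)
    exact mem_iUnion.2 ⟨j, hX, hj⟩
  have hS : ∀ j, ∫⁻ X in S j, ‖gradient (ext Ω μ φ ξ g) X‖ₑ ^ 2 ∂m ≤
      ENNReal.ofReal (gradConst n c K ^ 2 * c ^ 6) * scaleEnergy Ω m μ g (26 * 2 ^ j) := by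
    intro j
    have hA : 0 ≤ gradConst n c K := by unfold gradConst; positivity
    have h2 : (0 : ℝ) < 2 ^ j := by positivity
    refine lintegral_sq_le_scaleEnergy h.doubling hg hgi (by positivity) (hSm j)
      inter_subset_left (fun X hX => ?_) hA fun X hX => ?_ <;>
      obtain ⟨hXΩ, hX1, hX2⟩ := hX <;> rw [zpow_add_one₀ two_ne_zero] at hX2
    · linarith
    · exact h.norm_gradient_ext_le hgi hXΩ (by linarith) (by linarith) _
  calc ∫⁻ X in Ω, ‖gradient (ext Ω μ φ ξ g) X‖ₑ ^ 2 ∂m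
      ≤ ∑' j, ∫⁻ X in S j, ‖gradient (ext Ω μ φ ξ g) X‖ₑ ^ 2 ∂m :=
        (lintegral_mono_set hcov).trans (lintegral_iUnion_le _ _)
    _ ≤ ∑' j, ENNReal.ofReal (gradConst n c K ^ 2 * c ^ 6) *
          scaleEnergy Ω m μ g (26 * 2 ^ j) := ENNReal.tsum_le_tsum hS
    _ ≤ ENNReal.ofReal (gradConst n c K ^ 2 * c ^ 6) *
          (ENNReal.ofReal (scaleConst c C₅) * hEnergy Ω m μ g) := by
        rw [ENNReal.tsum_mul_left]
        gcongr
        exact tsum_scaleEnergy_le h.isOpen h.doubling hm h5 hg (by norm_num)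
    _ = _ := by
        rw [← mul_assoc, ← ENNReal.ofReal_mul (by positivity)]

/-! ### Smooth averages near the boundary -/

/-- A smooth radial cutoff profile with Lipschitz constant `M`. -/
structure IsProfile {n : ℕ} (η : E n → ℝ) (M : ℝ) : Prop where
  contDiff : ContDiff ℝ ∞ η
  hasCompactSupport : HasCompactSupport η
  nonneg : ∀ x, 0 ≤ η x
  le_one : ∀ x, η x ≤ 1
  eq_one : ∀ x, ‖x‖ ≤ 1 → η x = 1
  eq_zero : ∀ x, 2 ≤ ‖x‖ → η x = 0
  lip_nonneg : 0 ≤ M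
  lip : ∀ x y, |η x - η y| ≤ M * ‖x - y‖

lemma exists_isProfile (n : ℕ) : ∃ (η : E n → ℝ) (M : ℝ), IsProfile η M := by
  let f : ContDiffBump (0 : E n) := ⟨1, 2, one_pos, one_lt_two⟩
  have hs : HasCompactSupport f := f.hasCompactSupport
  have hd : ContDiff ℝ ∞ f := f.contDiff
  obtain ⟨C, hC⟩ := hd.lipschitzWith_of_hasCompactSupport hs (by simp)
  refine ⟨f, C, hd, hs, fun x => f.nonneg, fun x => f.le_one, fun x hx => ?_, fun x hx => ?_,
    C.2, fun x y => ?_⟩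
  · exact f.one_of_mem_closedBall (by simpa using hx)
  · exact f.zero_of_le_dist (by simpa using hx)
  · simpa [Real.dist_eq, dist_eq_norm] using hC.dist_le_mul x y

section SmoothAverage

variable {n : ℕ} {Ω : Set (E n)} {μ : Measure (E n)} {c : ℝ} {g : E n → ℝ} {η : E n → ℝ} {M : ℝ}

/-- `∫ η((X - y)/ρ) g(y) dμ(y)`. -/
noncomputable def bumpInt (μ : Measure (E n)) (η : E n → ℝ) (ρ : ℝ) (g : E n → ℝ) (X : E n) : ℝ :=
  ∫ y, g y * η (ρ⁻¹ • (X - y)) ∂μ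

lemma contDiff_bumpInt (hη : IsProfile η M) {ρ : ℝ} (hρ : 0 < ρ) (hg : LocallyIntegrable g μ) :
    ContDiff ℝ ∞ (bumpInt μ η ρ g) := by
  have hs : HasCompactSupport fun x : E n => η (ρ⁻¹ • x) :=
    hη.hasCompactSupport.comp_smul (inv_ne_zero hρ.ne')
  have hd : ContDiff ℝ ∞ fun x : E n => η (ρ⁻¹ • x) := hη.contDiff.comp (contDiff_const_smul _)
  exact hs.contDiff_convolution_right (ContinuousLinearMap.mul ℝ ℝ) hg hd

lemma IsProfile.eq_zero_of_le_dist (hη : IsProfile η M) {ρ : ℝ} (hρ : 0 < ρ) {X y : E n}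
    (h : 2 * ρ ≤ dist y X) : η (ρ⁻¹ • (X - y)) = 0 := by
  refine hη.eq_zero _ ?_
  rw [norm_smul, norm_inv, Real.norm_of_nonneg hρ.le, ← dist_eq_norm, dist_comm, inv_mul_eq_div,
    le_div_iff₀ hρ]
  exact h

lemma IsProfile.eq_one_of_dist_le (hη : IsProfile η M) {ρ : ℝ} (hρ : 0 < ρ) {X y : E n}
    (h : dist y X ≤ ρ) : η (ρ⁻¹ • (X - y)) = 1 := by
  refine hη.eq_one _ ?_
  rw [norm_smul, norm_inv, Real.norm_of_nonneg hρ.le, ← dist_eq_norm, dist_comm, inv_mul_eq_div,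
    div_le_one hρ]
  exact h

lemma integrable_mul_bump [IsLocallyFiniteMeasure μ] (hη : IsProfile η M) {ρ : ℝ} (hρ : 0 < ρ)
    (hg : LocallyIntegrable g μ) (X : E n) :
    Integrable (fun y => g y * η (ρ⁻¹ • (X - y))) μ := by
  have hc : Continuous fun y => η (ρ⁻¹ • (X - y)) := by
    have := hη.contDiff.continuous
    fun_prop
  have hs : HasCompactSupport fun y => η (ρ⁻¹ • (X - y)) :=
    HasCompactSupport.of_support_subset_isCompact (isCompact_closedBall X (2 * ρ)) fun y hy => by
      by_contra h
      rw [Metric.mem_closedBall, not_le] at h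
      exact hy (hη.eq_zero_of_le_dist hρ h.le)
  have := hg.integrable_smul_left_of_hasCompactSupport hc hs
  simpa [mul_comm] using this

/-- An integral against differences of bumps is controlled on a ball that contains the supports. -/
lemma abs_integral_mul_le [IsLocallyFiniteMeasure μ] {U : Set (E n)} {ψ : E n → ℝ}
    (hgU : IntegrableOn g U μ) {B : ℝ} (hB : ∀ y, |ψ y| ≤ B)
    (hψ : ∀ y, y ∉ U → ψ y = 0) : |∫ y, g y * ψ y ∂μ| ≤ B * ∫ y in U, |g y| ∂μ := by
  rw [← setIntegral_eq_integral_of_forall_compl_eq_zero (s := U)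
    fun y hy => by simp [hψ y hy], ← integral_const_mul]
  exact norm_integral_le_of_norm_le (hgU.abs.const_mul B) (Eventually.of_forall fun y => by
    rw [Real.norm_eq_abs, abs_mul, mul_comm]
    exact mul_le_mul_of_nonneg_right (hB y) (abs_nonneg _))

lemma measureReal_le_bumpInt_one [IsLocallyFiniteMeasure μ] (hη : IsProfile η M) {ρ : ℝ}
    (hρ : 0 < ρ) (X : E n) : μ.real (Metric.ball X ρ) ≤ bumpInt μ η ρ (fun _ => 1) X := by
  rw [← integral_indicator_one measurableSet_ball]
  refine integral_mono ((integrable_indicator_iff measurableSet_ball).2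
    (integrableOn_const measure_ball_lt_top.ne))
    (integrable_mul_bump hη hρ (locallyIntegrable_const 1) X) fun y => ?_
  by_cases hy : y ∈ Metric.ball X ρ
  · simp [hy, hη.eq_one_of_dist_le hρ (Metric.mem_ball.1 hy).le]
  · simp [hy, hη.nonneg]

/-- Smooth functions on the whole space that are local averages of `g` near the boundary. -/
lemma exists_smoothAverage [IsLocallyFiniteMeasure μ] (hμ : IsDoublingOn (frontier Ω) μ c)
    (hη : IsProfile η M) (hg : LocallyIntegrable g μ) {τ : ℝ} (hτ : 0 < τ) :
    ∃ P : E n → ℝ, ContDiff ℝ ∞ P ∧ ∀ X, bdDist Ω X < τ → ∀ a : ℝ,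
      |P X - a| ≤ c ^ 5 * (⨍ z in Metric.ball X (21 * τ), |g z - a| ∂μ) ∧
      ∀ᶠ Z in 𝓝 X, |P Z - P X| ≤
        6 * c ^ 10 * M * (21 * τ)⁻¹ * (⨍ z in Metric.ball X (21 * τ), |g z - a| ∂μ) * ‖Z - X‖ := by
  have hc := hμ.one_lt
  have hM := hη.lip_nonneg
  -- A bump centered within `τ` of `X` is supported within `2ρ + τ = 15 τ` of `X`, inside the ball
  -- of radius `21 τ = 3ρ`.
  set ρ := 7 * τ with hρdef
  have hρ : 0 < ρ := by positivity
  -- The denominator `d` may vanish far from the boundary. Adding `q`, positive exactly where `δ >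
  -- 2τ`, keeps it positive without altering the quotient where `δ < τ`.
  obtain ⟨q, hqs, hqd, hqr⟩ : ∃ q : E n → ℝ, Function.support q = {X | 2 * τ < bdDist Ω X} ∧
      ContDiff ℝ ∞ q ∧ range q ⊆ Icc 0 1 :=
    (isOpen_lt continuous_const (continuous_bdDist Ω)).exists_contDiff_support_eq
  have hq0 : ∀ X, 0 ≤ q X := fun X => (hqr ⟨X, rfl⟩).1
  set d := bumpInt μ η ρ (fun _ => 1) with hd
  have hdlow : ∀ X, μ.real (Metric.ball X ρ) ≤ d X := measureReal_le_bumpInt_one hη hρ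
  have hpos : ∀ X, 0 < d X + q X := by
    intro X
    by_cases hX : 2 * τ < bdDist Ω X
    · have : q X ≠ 0 := by
        rw [← Function.mem_support, hqs]
        exact hX
      have h2 : 0 ≤ d X := measureReal_nonneg.trans (hdlow X)
      have h3 := lt_of_le_of_ne (hq0 X) this.symm
      linarith
    · have := (measureReal_ball_pos_of_near hμ (by linarith : bdDist Ω X < ρ)).trans_le (hdlow X)
      linarith [hq0 X]
  have hqz : ∀ X, bdDist Ω X < τ → q X = 0 := fun X hX => by
    by_contra h
    have : X ∈ Function.support q := h
    rw [hqs] at this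
    have : 2 * τ < bdDist Ω X := this
    linarith
  refine ⟨fun X => bumpInt μ η ρ g X / (d X + q X), (contDiff_bumpInt hη hρ hg).div
    ((contDiff_bumpInt hη hρ (locallyIntegrable_const 1)).add hqd) fun X => (hpos X).ne', ?_⟩
  intro X hX a
  set U := Metric.ball X (21 * τ) with hU
  have hgU : IntegrableOn (fun y => g y - a) U μ :=
    ((hg.integrableOn_isCompact (isCompact_closedBall X (21 * τ))).mono_set
      Metric.ball_subset_closedBall).sub (integrableOn_const measure_ball_lt_top.ne)
  set O := ⨍ z in U, |g z - a| ∂μ with hO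
  have hUpos : 0 < μ.real U := measureReal_ball_pos_of_near hμ (by linarith)
  have hOi : ∫ z in U, |g z - a| ∂μ = μ.real U * O := by
    rw [hO, setAverage_eq, smul_eq_mul, mul_inv_cancel_left₀ hUpos.ne']
  have hO0 : 0 ≤ O := by
    rw [hO, setAverage_eq]
    exact smul_nonneg (inv_nonneg.2 measureReal_nonneg) (integral_nonneg fun _ => abs_nonneg _)
  let G : E n → ℝ := bumpInt μ η ρ fun y => g y - a
  have hga : LocallyIntegrable (fun y => g y - a) μ := hg.sub (locallyIntegrable_const a)
  have hPG : ∀ Z, bdDist Ω Z < τ → bumpInt μ η ρ g Z / (d Z + q Z) = a + G Z / d Z := by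
    intro Z hZ
    have h1 : G Z = bumpInt μ η ρ g Z - a * d Z := by
      simp only [G, hd, bumpInt]
      rw [← integral_const_mul, ← integral_sub (integrable_mul_bump hη hρ hg Z)
        ((integrable_mul_bump hη hρ (locallyIntegrable_const 1) Z).const_mul a)]
      congr 1
      ext y
      ring
    have h2 := hpos Z
    rw [hqz Z hZ, add_zero] at h2 ⊢
    rw [h1]
    field_simp
    ring
  -- With `x` in the boundary within `τ` of `Z`: `U ⊆ B(x, 23 τ) ⊆ B(x, 2 ^ 5 τ)` and `B(x, τ) ⊆
  -- B(Z, ρ)`.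
  have hdU : ∀ Z, bdDist Ω Z < τ → dist Z X < τ → μ.real U ≤ c ^ 5 * d Z := by
    intro Z hZ hZX
    obtain ⟨x, hx, hxd⟩ := exists_mem_frontier_dist_lt hμ.nonempty hZ
    refine (hμ.measureReal_le_of_subset hx hτ (p := 5) (R := 23 * τ) (by linarith)
      (Metric.ball_subset_ball' ?_)).trans ?_
    · rw [dist_comm] at hZX
      linarith [dist_triangle X Z x]
    · gcongr
      refine (measureReal_mono (Metric.ball_subset_ball' ?_) measure_ball_lt_top.ne).trans (hdlow Z)
      rw [dist_comm]
      linarith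
  have hsupp : ∀ Z, dist Z X < τ → ∀ y, y ∉ U → η (ρ⁻¹ • (Z - y)) = 0 := by
    intro Z hZ y hy
    rw [hU, Metric.mem_ball, not_lt] at hy
    refine hη.eq_zero_of_le_dist hρ ?_
    linarith [dist_triangle y Z X]
  have hdX := hdU X hX (by simpa using hτ)
  have hdXpos : 0 < d X := by
    have := hpos X
    rwa [hqz X hX, add_zero] at this
  have hGX : |G X| ≤ μ.real U * O := by
    rw [← hOi, ← one_mul (∫ z in U, |g z - a| ∂μ)]
    refine abs_integral_mul_le hgU (fun y => ?_) (hsupp X (by simpa using hτ))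
    rw [abs_of_nonneg (hη.nonneg _)]
    exact hη.le_one _
  have hGdX : |G X / d X| ≤ c ^ 5 * O := by
    rw [abs_div, abs_of_pos hdXpos, div_le_iff₀ hdXpos]
    calc |G X| ≤ μ.real U * O := hGX
      _ ≤ c ^ 5 * d X * O := by gcongr
      _ = _ := by ring
  refine ⟨?_, ?_⟩
  · simp only [hPG X hX, add_sub_cancel_left]
    exact hGdX
  have hnear : ∀ᶠ Z in 𝓝 X, bdDist Ω Z < τ :=
    (continuous_bdDist Ω).continuousAt.eventually_lt continuousAt_const hX
  filter_upwards [hnear, Metric.ball_mem_nhds X hτ] with Z hZ hZX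
  rw [Metric.mem_ball] at hZX
  have hdZ := hdU Z hZ hZX
  have hdZpos : 0 < d Z := by
    have := hpos Z
    rwa [hqz Z hZ, add_zero] at this
  have hlip : ∀ y, |η (ρ⁻¹ • (Z - y)) - η (ρ⁻¹ • (X - y))| ≤ M * ρ⁻¹ * ‖Z - X‖ := fun y => by
    refine (hη.lip _ _).trans (le_of_eq ?_)
    rw [← smul_sub, sub_sub_sub_cancel_right, norm_smul, norm_inv, Real.norm_of_nonneg hρ.le,
      mul_assoc]
  have hdiff : ∀ {f : E n → ℝ}, LocallyIntegrable f μ → IntegrableOn f U μ →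
      |bumpInt μ η ρ f Z - bumpInt μ η ρ f X| ≤ M * ρ⁻¹ * ‖Z - X‖ * ∫ y in U, |f y| ∂μ := by
    intro f hf hfU
    have e : bumpInt μ η ρ f Z - bumpInt μ η ρ f X =
        ∫ y, f y * (η (ρ⁻¹ • (Z - y)) - η (ρ⁻¹ • (X - y))) ∂μ := by
      unfold bumpInt
      rw [← integral_sub (integrable_mul_bump hη hρ hf Z) (integrable_mul_bump hη hρ hf X)]
      congr 1
      ext y
      ring
    rw [e]
    refine abs_integral_mul_le hfU hlip fun y hy => ?_
    rw [hsupp Z hZX y hy, hsupp X (by simpa using hτ) y hy, sub_zero]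
  have hG' : |G Z - G X| ≤ M * ρ⁻¹ * ‖Z - X‖ * (μ.real U * O) := hOi ▸ hdiff hga hgU
  have hd' : |d Z - d X| ≤ M * ρ⁻¹ * ‖Z - X‖ * μ.real U := by
    have := hdiff (f := fun _ => 1) (locallyIntegrable_const 1)
      (integrableOn_const measure_ball_lt_top.ne)
    simpa using this
  -- The quotient rule for finite differences. Its two terms each carry `ρ⁻¹ = 3 (21 τ)⁻¹`, whence
  -- the factor `6`.
  have e : a + G Z / d Z - (a + G X / d X) =
      (G Z - G X) / d Z - G X / d X * ((d Z - d X) / d Z) := by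
    field_simp
    ring
  set L := M * ρ⁻¹ * ‖Z - X‖ with hL
  have hL0 : 0 ≤ L := by positivity
  have b1 : |(G Z - G X) / d Z| ≤ L * (c ^ 5 * O) := by
    rw [abs_div, abs_of_pos hdZpos, div_le_iff₀ hdZpos]
    calc _ ≤ L * (μ.real U * O) := hG'
      _ ≤ L * (c ^ 5 * d Z * O) := by gcongr
      _ = _ := by ring
  have b2 : |(d Z - d X) / d Z| ≤ L * c ^ 5 := by
    rw [abs_div, abs_of_pos hdZpos, div_le_iff₀ hdZpos]
    calc _ ≤ L * μ.real U := hd'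
      _ ≤ L * (c ^ 5 * d Z) := by gcongr
      _ = _ := by ring
  have b3 : c ^ 5 ≤ c ^ 10 := pow_le_pow_right₀ hc.le (by norm_num)
  simp only [hPG X hX, hPG Z hZ]
  rw [e]
  calc _ ≤ |(G Z - G X) / d Z| + |G X / d X * ((d Z - d X) / d Z)| := abs_sub _ _
    _ ≤ L * (c ^ 5 * O) + c ^ 5 * O * (L * c ^ 5) := by
        rw [abs_mul]
        gcongr
    _ ≤ L * (c ^ 10 * O) + c ^ 10 * O * L := by
        have : c ^ 5 * O * (L * c ^ 5) = c ^ 10 * O * L := by ring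
        rw [this]
        gcongr
    _ = 6 * c ^ 10 * M * (21 * τ)⁻¹ * O * ‖Z - X‖ := by
        rw [hL, hρdef]
        field_simp
        ring

end SmoothAverage

/-! ### Smooth approximation of the extension -/

lemma setAverage_abs_nonneg {n : ℕ} {μ : Measure (E n)} {U : Set (E n)} (f : E n → ℝ) :
    0 ≤ ⨍ z in U, |f z| ∂μ := by
  rw [setAverage_eq]
  exact smul_nonneg (inv_nonneg.2 measureReal_nonneg) (integral_nonneg fun _ => abs_nonneg _)

lemma enorm_sub_sq_le {F : Type*} [SeminormedAddCommGroup F] (a b : F) :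
    ‖a - b‖ₑ ^ 2 ≤ 2 * ‖a‖ₑ ^ 2 + 2 * ‖b‖ₑ ^ 2 := by
  have h1 : ‖a - b‖ ^ 2 ≤ 2 * ‖a‖ ^ 2 + 2 * ‖b‖ ^ 2 := by
    have := norm_sub_le a b
    nlinarith [norm_nonneg (a - b), sq_nonneg (‖a‖ - ‖b‖)]
  rw [← ofReal_norm, ← ofReal_norm, ← ofReal_norm, ← ENNReal.ofReal_pow (norm_nonneg _),
    ← ENNReal.ofReal_pow (norm_nonneg _), ← ENNReal.ofReal_pow (norm_nonneg _),
    ← ENNReal.ofReal_ofNat 2, ← ENNReal.ofReal_mul (by norm_num),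
    ← ENNReal.ofReal_mul (by norm_num), ← ENNReal.ofReal_add (by positivity) (by positivity)]
  exact ENNReal.ofReal_le_ofReal h1

/-- The constant in the gradient estimate for the approximants. -/
noncomputable def approxConst (n : ℕ) (c K M : ℝ) : ℝ :=
  6 * c ^ 10 * M + nearCount n * (|K| * (588 * n) * (c ^ (11 + n) + c ^ 5))

namespace ExtensionSetting

variable {n : ℕ} {Ω : Set (E n)} {m μ : Measure (E n)} {c C₄ C₅ K M : ℝ}
  {φ : Dyadic n → E n → ℝ} {ξ : Dyadic n → E n} {g : E n → ℝ} {η : E n → ℝ}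

open Classical in
/-- The extension with its small scales replaced by `P`. -/
noncomputable def truncExt (Ω : Set (E n)) (μ : Measure (E n)) (φ : Dyadic n → E n → ℝ)
    (ξ : Dyadic n → E n) (g P : E n → ℝ) (t : ℝ) (X : E n) : ℝ :=
  P X + ∑' I : whitney Ω, φ I X *
    (if t ≤ side (I : Dyadic n) then cubeAvg μ ξ g I - P X else 0)

open Classical in
lemma truncExt_eq_sum (h : ExtensionSetting Ω μ c K φ ξ) {P : E n → ℝ} {t : ℝ} {X Z : E n}
    (hZ : Z ∈ Metric.ball X (bdDist Ω X / 2)) {F : Finset (Dyadic n)}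
    (hF : (F : Set (Dyadic n)) = nearCubes Ω X) :
    truncExt Ω μ φ ξ g P t Z =
      P Z + ∑ I ∈ F, φ I Z * (if t ≤ side I then cubeAvg μ ξ g I - P Z else 0) := by
  unfold truncExt
  rw [h.tsum_eq_sum hZ hF fun I => if t ≤ side I then cubeAvg μ ξ g I - P Z else 0]

/-- Cubes of side at least `t` have doubles at distance at least `4t` from the boundary. Hence near
any point outside `Ω`, boundary points included, the sum vanishes and only `P` remains. -/
lemma contDiff_truncExt (h : ExtensionSetting Ω μ c K φ ξ) {P : E n → ℝ} (hP : ContDiff ℝ ∞ P)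
    {t : ℝ} (ht : 0 < t) : ContDiff ℝ ∞ (truncExt Ω μ φ ξ g P t) := by
  classical
  refine contDiff_iff_contDiffAt.2 fun X => ?_
  by_cases hX : X ∈ Ω
  · obtain ⟨F, hF, -⟩ := h.exists_finset hX
    have hs : ContDiff ℝ ∞ fun Z =>
        P Z + ∑ I ∈ F, φ I Z * (if t ≤ side I then cubeAvg μ ξ g I - P Z else 0) := by
      refine hP.add (ContDiff.sum fun I hI =>
        (h.partition.smooth I (show I ∈ nearCubes Ω X from hF ▸ hI).1).mul ?_)
      split_ifs
      · exact contDiff_const.sub hP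
      · exact contDiff_const
    refine hs.contDiffAt.congr_of_eventuallyEq ?_
    filter_upwards [Metric.isOpen_ball.mem_nhds (h.mem_ball_self hX)] with Z hZ
    exact h.truncExt_eq_sum hZ hF
  · refine hP.contDiffAt.congr_of_eventuallyEq ?_
    filter_upwards [Metric.ball_mem_nhds X ht] with Z hZ
    have hzero : ∀ I : whitney Ω, φ I Z *
        (if t ≤ side (I : Dyadic n) then cubeAvg μ ξ g I - P Z else 0) = 0 := by
      intro I
      split_ifs with hI
      · rw [mul_eq_zero]
        left
        by_contra hφ
        have hZI := dilate_mono (by norm_num : (2 : ℝ) ≤ 4) _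
          (h.partition.support_subset I I.2 hφ)
        have h1 := four_mul_side_le_bdDist h.doubling.nonempty I.2 hZI
        have h2 := h.side_le_sqrt_mul I
        refine hX (ball_bdDist_subset (dilate_subset h.dim_pos h.doubling.nonempty I.2 hZI) ?_)
        rw [Metric.mem_ball] at hZ
        rw [Metric.mem_ball, dist_comm]
        linarith
      · simp
    simp [truncExt, hzero]

/-- At this depth every near cube has side at least `t`, as `δ(X) ≤ 28 √n side I`. Nothing is
discarded, and `P` cancels because the weights sum to `1`. -/
lemma truncExt_eq_ext (h : ExtensionSetting Ω μ c K φ ξ) {P : E n → ℝ} {t : ℝ} {X Z : E n}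
    (hX : X ∈ Ω) (ht : 28 * n * t ≤ bdDist Ω X) (hZ : Z ∈ Metric.ball X (bdDist Ω X / 2)) :
    truncExt Ω μ φ ξ g P t Z = ext Ω μ φ ξ g Z := by
  classical
  obtain ⟨F, hF, -⟩ := h.exists_finset hX
  have h1 := h.sum_eq_one hX hZ hF
  have h2 : ∀ I ∈ F, t ≤ side I := fun I hI => by
    have b1 := bdDist_le_of_mem_nearCubes h.doubling.nonempty
      (show I ∈ nearCubes Ω X from hF ▸ hI)
    have b2 : √n * side I ≤ n * side I := by
      have := side_pos I
      gcongr
      exact h.sqrt_le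
    have hn : (0 : ℝ) < n := by exact_mod_cast h.dim_pos
    have b3 : n * t ≤ n * side I := by linarith
    exact le_of_mul_le_mul_left b3 hn
  rw [h.truncExt_eq_sum hZ hF, h.ext_eq_sum hZ hF,
    Finset.sum_congr rfl fun I hI => by rw [if_pos (h2 I hI)]]
  simp only [mul_sub, Finset.sum_sub_distrib, ← Finset.sum_mul, h1]
  ring

lemma gradient_truncExt_eq (h : ExtensionSetting Ω μ c K φ ξ) {P : E n → ℝ} {t : ℝ} {X : E n}
    (hX : X ∈ Ω) (ht : 28 * n * t ≤ bdDist Ω X) :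
    gradient (truncExt Ω μ φ ξ g P t) X = gradient (ext Ω μ φ ξ g) X := by
  unfold gradient
  congr 1
  refine EventuallyEq.fderiv_eq ?_
  filter_upwards [Metric.isOpen_ball.mem_nhds (h.mem_ball_self hX)] with Z hZ
  exact h.truncExt_eq_ext hX ht hZ

/-- In the layer, every surviving cube has side at least `t`, so `|∇φ_I| ≤ |K|/t`, while its average
and `P X` are both close to `a`. The radius is `21 · 28 n t = 588 n t`. -/
lemma exists_approx [IsLocallyFiniteMeasure μ] (h : ExtensionSetting Ω μ c K φ ξ)
    (hη : IsProfile η M) (hg : LocallyIntegrable g μ) {t : ℝ} (ht : 0 < t) :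
    ∃ u : E n → ℝ, ContDiff ℝ ∞ u ∧
      (∀ X ∈ Ω, 28 * n * t ≤ bdDist Ω X → u X = ext Ω μ φ ξ g X) ∧
      (∀ X ∈ Ω, 28 * n * t ≤ bdDist Ω X → gradient u X = gradient (ext Ω μ φ ξ g) X) ∧
      ∀ X ∈ Ω, bdDist Ω X < 28 * n * t → ∀ a : ℝ, ‖gradient u X‖ ≤
        approxConst n c K M * (588 * n * t)⁻¹ *
          ⨍ z in Metric.ball X (588 * n * t), |g z - a| ∂μ := by
  classical
  have hn : (0 : ℝ) < n := by exact_mod_cast h.dim_pos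
  have hc := h.doubling.one_lt
  have hM := hη.lip_nonneg
  obtain ⟨P, hPs, hP⟩ := exists_smoothAverage h.doubling hη hg (τ := 28 * n * t) (by positivity)
  refine ⟨truncExt Ω μ φ ξ g P t, h.contDiff_truncExt hPs ht,
    fun X hX hXt => h.truncExt_eq_ext hX hXt (h.mem_ball_self hX),
    fun X hX hXt => h.gradient_truncExt_eq hX hXt, fun X hX hXt a => ?_⟩
  obtain ⟨hP1, hP2⟩ := hP X hXt a
  have hR : 21 * (28 * n * t) = 588 * n * t := by ring
  rw [hR] at hP1 hP2
  set R := 588 * n * t with hRdef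
  have hRpos : 0 < R := by positivity
  set O := ⨍ z in Metric.ball X R, |g z - a| ∂μ with hO
  have hO0 : 0 ≤ O := setAverage_abs_nonneg _
  obtain ⟨F, hF, hcard⟩ := h.exists_finset hX
  have hX' := h.mem_ball_self hX
  rw [norm_gradient]
  refine norm_fderiv_le_of_lip' ℝ (by unfold approxConst; positivity) ?_
  filter_upwards [hP2, Metric.isOpen_ball.mem_nhds hX'] with Z hPZ hZ
  let χ : Dyadic n → ℝ := fun I => if t ≤ side I then 1 else 0
  have hχ : ∀ (I : Dyadic n) (b : ℝ), (if t ≤ side I then b else 0) = χ I * b := fun I b => by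
    simp only [χ, ite_mul, one_mul, zero_mul]
  -- Discrete product rule: the increment of `P` carries a coefficient in `[0, 1]`, and the
  -- increments of `φ_I` multiply the bounded differences.
  have e1 : truncExt Ω μ φ ξ g P t Z - truncExt Ω μ φ ξ g P t X =
      (P Z - P X) * (1 - ∑ I ∈ F, φ I Z * χ I) +
        ∑ I ∈ F, (φ I Z - φ I X) * (χ I * (cubeAvg μ ξ g I - P X)) := by
    rw [h.truncExt_eq_sum hX' hF, h.truncExt_eq_sum hZ hF]
    simp only [hχ]
    have e0 : ∑ I ∈ F, φ I Z * (χ I * (cubeAvg μ ξ g I - P Z)) -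
        ∑ I ∈ F, φ I X * (χ I * (cubeAvg μ ξ g I - P X)) + (P Z - P X) * ∑ I ∈ F, φ I Z * χ I =
        ∑ I ∈ F, (φ I Z - φ I X) * (χ I * (cubeAvg μ ξ g I - P X)) := by
      rw [Finset.mul_sum, ← Finset.sum_sub_distrib, ← Finset.sum_add_distrib]
      refine Finset.sum_congr rfl fun I _ => ?_
      ring
    linear_combination e0
  have e2 : |1 - ∑ I ∈ F, φ I Z * χ I| ≤ 1 := by
    have hχ0 : ∀ I, 0 ≤ χ I ∧ χ I ≤ 1 := fun I => by
      simp only [χ]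
      split_ifs <;> norm_num
    have hp := h.phi_nonneg hF Z
    have s0 : 0 ≤ ∑ I ∈ F, φ I Z * χ I :=
      Finset.sum_nonneg fun I hI => mul_nonneg (hp I hI) (hχ0 I).1
    have s1 : ∑ I ∈ F, φ I Z * χ I ≤ 1 := by
      rw [← h.sum_eq_one hX hZ hF]
      exact Finset.sum_le_sum fun I hI => mul_le_of_le_one_right (hp I hI) (hχ0 I).2
    rw [abs_le]
    constructor <;> linarith
  have key : ∀ I ∈ F, |(φ I Z - φ I X) * (χ I * (cubeAvg μ ξ g I - P X))| ≤
      (|K| * (588 * n) * (c ^ (11 + n) + c ^ 5)) * R⁻¹ * O * ‖Z - X‖ := by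
    intro I hI
    have hI' : I ∈ nearCubes Ω X := hF ▸ hI
    have hs := side_pos I
    by_cases hlt : t ≤ side I
    · have b1 : χ I = 1 := if_pos hlt
      have b2 : |cubeAvg μ ξ g I - a| ≤ c ^ (11 + n) * O := by
        refine h.abs_cubeAvg_sub_le hg hI'.1
          ((h.dist_center_le_of_mem_nearCubes hI').trans ?_) ?_ a
        · have : 0 < n * t := by positivity
          rw [hRdef]
          linarith
        · have h2n : (n : ℝ) ≤ 2 ^ n := by exact_mod_cast Nat.lt_two_pow_self.le
          have h3 : n * t ≤ 2 ^ n * side I := by gcongr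
          have h4 : 0 < n * t := by positivity
          calc R + R ≤ 2 ^ 11 * (n * t) := by rw [hRdef]; linarith
            _ ≤ 2 ^ 11 * (2 ^ n * side I) := by gcongr
            _ = _ := by ring
      have b3 : |cubeAvg μ ξ g I - P X| ≤ (c ^ (11 + n) + c ^ 5) * O := by
        have := abs_sub_le (cubeAvg μ ξ g I) a (P X)
        rw [abs_sub_comm a] at this
        linarith
      have b4 : |K| / side I ≤ |K| * (588 * n) * R⁻¹ := by
        have : |K| * (588 * n) * R⁻¹ = |K| / t := by
          rw [hRdef]
          field_simp
        rw [this]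
        gcongr
      rw [b1, one_mul, abs_mul]
      calc _ ≤ (|K| / side I * ‖Z - X‖) * ((c ^ (11 + n) + c ^ 5) * O) := by
            gcongr
            exact h.abs_phi_sub_le hI'.1 X Z
        _ ≤ (|K| * (588 * n) * R⁻¹ * ‖Z - X‖) * ((c ^ (11 + n) + c ^ 5) * O) := by gcongr
        _ = _ := by ring
    · have b1 : χ I = 0 := if_neg hlt
      rw [b1]
      simp only [zero_mul, mul_zero, abs_zero]
      positivity
  rw [e1, Real.norm_eq_abs]
  calc _ ≤ |(P Z - P X) * (1 - ∑ I ∈ F, φ I Z * χ I)| +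
        |∑ I ∈ F, (φ I Z - φ I X) * (χ I * (cubeAvg μ ξ g I - P X))| := abs_add_le _ _
    _ ≤ (6 * c ^ 10 * M * R⁻¹ * O * ‖Z - X‖) * 1 +
        F.card • ((|K| * (588 * n) * (c ^ (11 + n) + c ^ 5)) * R⁻¹ * O * ‖Z - X‖) := by
        refine add_le_add ?_ ((Finset.abs_sum_le_sum_abs _ _).trans
          (Finset.sum_le_card_nsmul _ _ _ key))
        rw [abs_mul]
        gcongr
    _ ≤ (6 * c ^ 10 * M * R⁻¹ * O * ‖Z - X‖) * 1 +
        nearCount n * ((|K| * (588 * n) * (c ^ (11 + n) + c ^ 5)) * R⁻¹ * O * ‖Z - X‖) := by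
        rw [nsmul_eq_mul]
        gcongr
    _ = _ := by
        unfold approxConst
        ring

/-- Continuity from above of the finite measure `|V|² dm`: the layers have empty intersection in
`Ω`, where `δ > 0`. -/
lemma tendsto_energy_near_boundary [IsLocallyFiniteMeasure m]
    (h : ExtensionSetting Ω μ c K φ ξ) {V : E n → E n} (hV : ∫⁻ X in Ω, ‖V X‖ₑ ^ 2 ∂m < ⊤)
    {s : ℕ → ℝ} (hs : Antitone s) (hs0 : Tendsto s atTop (𝓝 0)) :
    Tendsto (fun k => ∫⁻ X in Ω ∩ {X | bdDist Ω X < s k}, ‖V X‖ₑ ^ 2 ∂m) atTop (𝓝 0) := by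
  have hT : ∀ k, MeasurableSet {X | bdDist Ω X < s k} := fun k =>
    measurableSet_lt (continuous_bdDist Ω).measurable measurable_const
  set ν := (m.restrict Ω).withDensity fun X => ‖V X‖ₑ ^ 2 with hν
  have hfin : ν univ ≠ ⊤ := by
    rw [hν, withDensity_apply _ MeasurableSet.univ, Measure.restrict_univ]
    exact hV.ne
  have h1 : ∀ k, ∫⁻ X in Ω ∩ {X | bdDist Ω X < s k}, ‖V X‖ₑ ^ 2 ∂m =
      ν {X | bdDist Ω X < s k} := fun k => by
    rw [hν, withDensity_apply _ (hT k), Measure.restrict_restrict (hT k), inter_comm]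
  simp only [h1]
  have h2 := tendsto_measure_iInter_atTop (μ := ν) (fun k => (hT k).nullMeasurableSet)
    (fun i j hij X (hX : bdDist Ω X < s j) => hX.trans_le (hs hij))
    ⟨0, measure_ne_top_of_subset (subset_univ _) hfin⟩
  have h3 : ν (⋂ k, {X | bdDist Ω X < s k}) = 0 := by
    refine measure_mono_null (t := Ωᶜ) (fun X hX hXΩ => ?_) ?_
    · have hpos := bdDist_pos h.isOpen h.doubling.nonempty hXΩ
      obtain ⟨k, hk⟩ := (hs0.eventually_lt_const hpos).exists
      exact lt_asymm hk (mem_iInter.1 hX k)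
    · refine withDensity_absolutelyContinuous _ _ ?_
      rw [Measure.restrict_apply h.isOpen.measurableSet.compl]
      simp
  rwa [h3] at h2

/-- The extension of `g ∈ H` belongs to `W`, with its classical gradient. -/
lemma hasWGradient_ext [IsLocallyFiniteMeasure m] [IsLocallyFiniteMeasure μ]
    (h : ExtensionSetting Ω μ c K φ ξ) (hm : H4 Ω m C₄) (h5 : H5 Ω m μ C₅)
    (hg : Measurable g) (hgi : LocallyIntegrable g μ) (hE : hEnergy Ω m μ g < ⊤) :
    HasWGradient Ω m (ext Ω μ φ ξ g) (gradient (ext Ω μ φ ξ g)) := by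
  have hn : (0 : ℝ) < n := by exact_mod_cast h.dim_pos
  have hc := h.doubling.one_lt
  obtain ⟨η, M, hη⟩ := exists_isProfile n
  have hM := hη.lip_nonneg
  have hVfin : ∫⁻ X in Ω, ‖gradient (ext Ω μ φ ξ g) X‖ₑ ^ 2 ∂m < ⊤ :=
    (h.lintegral_gradient_ext_le hm h5 hg hgi).trans_lt
      (ENNReal.mul_lt_top ENNReal.ofReal_lt_top hE)
  have hVm : AEStronglyMeasurable (gradient (ext Ω μ φ ξ g)) (m.restrict Ω) :=
    (h.continuousOn_gradient_ext g).aestronglyMeasurable h.isOpen.measurableSet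
  let t : ℕ → ℝ := fun k => 2⁻¹ ^ k
  have ht : ∀ k, 0 < t k := fun k => by positivity
  choose u hus hueq hugrad hubound using fun k => h.exists_approx hη hgi (ht k)
  let s : ℕ → ℝ := fun k => 28 * n * t k
  have hta : Antitone t := fun i j hij => pow_le_pow_of_le_one (by norm_num) (by norm_num) hij
  have ht0 : Tendsto t atTop (𝓝 0) :=
    tendsto_pow_atTop_nhds_zero_of_lt_one (by norm_num) (by norm_num)
  have hsa : Antitone s := fun i j hij => by
    have := hta hij
    simp only [s]
    gcongr
  have hs0 : Tendsto s atTop (𝓝 0) := by simpa using ht0.const_mul (28 * n : ℝ)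
  let T : ℕ → Set (E n) := fun k => Ω ∩ {X | bdDist Ω X < s k}
  have hT : ∀ k, MeasurableSet (T k) := fun k => h.isOpen.measurableSet.inter
    (measurableSet_lt (continuous_bdDist Ω).measurable measurable_const)
  have hA : 0 ≤ approxConst n c K M := by unfold approxConst; positivity
  -- These scales form a subfamily of a convergent series over all dyadic multiples of `588 n`.
  have hscale : Tendsto (fun k => scaleEnergy Ω m μ g (588 * n * t k)) atTop (𝓝 0) := by
    have hsum : ∑' j : ℤ, scaleEnergy Ω m μ g (588 * n * 2 ^ j) ≠ ⊤ :=
      ((tsum_scaleEnergy_le h.isOpen h.doubling hm h5 hg (by positivity)).trans_lt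
        (ENNReal.mul_lt_top ENNReal.ofReal_lt_top hE)).ne
    have hinj : Function.Injective fun k : ℕ => -(k : ℤ) := fun a b hab => by simpa using hab
    have := (ENNReal.tendsto_cofinite_zero_of_tsum_ne_top hsum).comp hinj.tendsto_cofinite
    rw [Nat.cofinite_eq_atTop] at this
    refine this.congr fun k => ?_
    simp only [Function.comp_apply, t, zpow_neg, zpow_natCast, inv_pow]
  have hu : ∀ k, ∫⁻ X in T k, ‖gradient (u k) X‖ₑ ^ 2 ∂m ≤
      ENNReal.ofReal (approxConst n c K M ^ 2 * c ^ 6) *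
        scaleEnergy Ω m μ g (588 * n * t k) := fun k =>
    lintegral_sq_le_scaleEnergy h.doubling hg hgi (by have := ht k; positivity) (hT k)
      inter_subset_left
      (fun X hX => by
        have h1 : bdDist Ω X < 28 * n * t k := hX.2
        have h2 : 0 < n * t k := mul_pos hn (ht k)
        linarith) hA
      fun X hX => hubound k X hX.1 hX.2 _
  -- The gradients agree outside the layer `T k`, so only the layer contributes.
  have hdiff : ∀ k, ∫⁻ X in Ω, ‖gradient (u k) X - gradient (ext Ω μ φ ξ g) X‖ₑ ^ 2 ∂m ≤
      2 * (ENNReal.ofReal (approxConst n c K M ^ 2 * c ^ 6) *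
        scaleEnergy Ω m μ g (588 * n * t k)) +
      2 * ∫⁻ X in T k, ‖gradient (ext Ω μ φ ξ g) X‖ₑ ^ 2 ∂m := by
    intro k
    calc ∫⁻ X in Ω, ‖gradient (u k) X - gradient (ext Ω μ φ ξ g) X‖ₑ ^ 2 ∂m
        = ∫⁻ X in Ω, (T k).indicator
            (fun X => ‖gradient (u k) X - gradient (ext Ω μ φ ξ g) X‖ₑ ^ 2) X ∂m := by
          refine setLIntegral_congr_fun h.isOpen.measurableSet fun X hX => ?_
          by_cases hXT : X ∈ T k
          · simp only [indicator_of_mem hXT]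
          · have hle : 28 * n * t k ≤ bdDist Ω X := not_lt.1 fun hlt => hXT ⟨hX, hlt⟩
            simp only [indicator_of_notMem hXT]
            rw [hugrad k X hX hle, sub_self]
            simp
      _ = ∫⁻ X in T k, ‖gradient (u k) X - gradient (ext Ω μ φ ξ g) X‖ₑ ^ 2 ∂m := by
          rw [lintegral_indicator (hT k), Measure.restrict_restrict (hT k),
            inter_eq_self_of_subset_left (inter_subset_left : T k ⊆ Ω)]
      _ ≤ ∫⁻ X in T k, (2 * ‖gradient (u k) X‖ₑ ^ 2 +
            2 * ‖gradient (ext Ω μ φ ξ g) X‖ₑ ^ 2) ∂m :=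
          lintegral_mono fun X => enorm_sub_sq_le _ _
      _ = 2 * ∫⁻ X in T k, ‖gradient (u k) X‖ₑ ^ 2 ∂m +
            2 * ∫⁻ X in T k, ‖gradient (ext Ω μ φ ξ g) X‖ₑ ^ 2 ∂m := by
          rw [lintegral_add_right', lintegral_const_mul' _ _ ENNReal.ofNat_ne_top,
            lintegral_const_mul' _ _ ENNReal.ofNat_ne_top]
          exact ((hVm.mono_measure (Measure.restrict_mono inter_subset_left le_rfl)).enorm.pow_const
            2).const_mul 2
      _ ≤ _ := by
          gcongr
          exact hu k
  have hlim : Tendsto (fun k => 2 * (ENNReal.ofReal (approxConst n c K M ^ 2 * c ^ 6) *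
        scaleEnergy Ω m μ g (588 * n * t k)) +
      2 * ∫⁻ X in T k, ‖gradient (ext Ω μ φ ξ g) X‖ₑ ^ 2 ∂m) atTop (𝓝 0) := by
    have h1 := ENNReal.Tendsto.const_mul (a := 2) (ENNReal.Tendsto.const_mul
      (a := ENNReal.ofReal (approxConst n c K M ^ 2 * c ^ 6)) hscale
      (Or.inr ENNReal.ofReal_ne_top)) (Or.inr ENNReal.ofNat_ne_top)
    have h2 := ENNReal.Tendsto.const_mul (a := 2) (h.tendsto_energy_near_boundary hVfin hsa hs0)
      (Or.inr ENNReal.ofNat_ne_top)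
    simpa using h1.add h2
  have hconv : Tendsto (fun k => ∫⁻ X in Ω,
      ‖gradient (u k) X - gradient (ext Ω μ φ ξ g) X‖ₑ ^ 2 ∂m) atTop (𝓝 0) :=
    tendsto_of_tendsto_of_tendsto_of_le_of_le tendsto_const_nhds hlim (fun _ => zero_le) hdiff
  refine ⟨(h.continuousOn_ext g).locallyIntegrableOn h.isOpen.measurableSet, ⟨hVm, ?_⟩, ?_⟩
  · rw [eLpNorm_lt_top_iff_lintegral_rpow_enorm_lt_top two_ne_zero ENNReal.ofNat_ne_top]
    simpa using hVfin
  have hufin : ∀ k, ∫⁻ X in Ω, ‖gradient (u k) X‖ₑ ^ 2 ∂m < ⊤ := by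
    intro k
    have e : ∫⁻ X in Ω, ‖gradient (u k) X‖ₑ ^ 2 ∂m ≤
        ∫⁻ X in T k, ‖gradient (u k) X‖ₑ ^ 2 ∂m +
          ∫⁻ X in Ω, ‖gradient (ext Ω μ φ ξ g) X‖ₑ ^ 2 ∂m := by
      rw [← lintegral_inter_add_sdiff _ Ω (hT k),
        inter_eq_self_of_subset_right (inter_subset_left : T k ⊆ Ω)]
      refine add_le_add le_rfl (le_trans (le_of_eq ?_)
        (lintegral_mono_set (sdiff_subset : Ω \ T k ⊆ Ω)))
      refine setLIntegral_congr_fun (h.isOpen.measurableSet.diff (hT k)) fun X hX => ?_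
      have hle : 28 * n * t k ≤ bdDist Ω X := not_lt.1 fun hlt => hX.2 ⟨hX.1, hlt⟩
      simp only [hugrad k X hX.1 hle]
    refine e.trans_lt (ENNReal.add_lt_top.2 ⟨(hu k).trans_lt ?_, hVfin⟩)
    refine ENNReal.mul_lt_top ENNReal.ofReal_lt_top ?_
    -- A single scale is the term `j = 0` of the series with base `588 n t k`.
    have h1 := ENNReal.le_tsum (f := fun j : ℤ => scaleEnergy Ω m μ g (588 * n * t k * 2 ^ j)) 0
    simp only [zpow_zero, mul_one] at h1
    exact h1.trans_lt ((tsum_scaleEnergy_le h.isOpen h.doubling hm h5 hg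
      (by have := ht k; positivity)).trans_lt (ENNReal.mul_lt_top ENNReal.ofReal_lt_top hE))
  refine ⟨u, hus, hufin, fun X₀ r hr hball => ?_, hconv⟩
  -- `2B ⊆ Ω` forces `δ ≥ r` on `B`, so `u k` equals the extension on `B` as soon as `s k < r`.
  refine tendsto_const_nhds.congr' ?_
  filter_upwards [hs0.eventually_lt_const hr] with k hk
  refine (setLIntegral_eq_zero measurableSet_ball fun X hX => ?_).symm
  have hXΩ : X ∈ Ω := hball (Metric.ball_subset_ball (by linarith) hX)
  have hδ : r ≤ bdDist Ω X := by
    refine (Metric.le_infDist h.doubling.nonempty).2 fun y hy => ?_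
    by_contra! hlt
    rw [h.isOpen.frontier_eq] at hy
    refine hy.2 (hball ?_)
    rw [Metric.mem_ball] at *
    rw [dist_comm] at hlt
    linarith [dist_triangle y X X₀]
  rw [hueq k X hXΩ (hk.le.trans hδ)]
  simp

end ExtensionSetting

/-! ### Uniqueness of the gradient, and the conclusion -/

lemma gradient_sub {n : ℕ} {f g : E n → ℝ} {X : E n} (hf : DifferentiableAt ℝ f X)
    (hg : DifferentiableAt ℝ g X) :
    gradient (fun Z => f Z - g Z) X = gradient f X - gradient g X := by
  unfold gradient
  rw [fderiv_fun_sub hf hg, map_sub]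

/-- On `B(X, δ(X)/2)` the differences of the two approximating sequences tend to `0` in `L¹` while
their gradients tend to `v₁ - v₂` in `L²`, so (H6) applies. A set that is null near each of its
points is null. -/
lemma HasWGradient.ae_eq {n : ℕ} {Ω : Set (E n)} {m : Measure (E n)} {C₆ : ℝ} {u : E n → ℝ}
    {v₁ v₂ : E n → E n} (hΩ : IsOpen Ω) (hne : (frontier Ω).Nonempty) (h6 : H6 Ω m C₆)
    (h₁ : HasWGradient Ω m u v₁) (h₂ : HasWGradient Ω m u v₂) : v₁ =ᵐ[m.restrict Ω] v₂ := by
  obtain ⟨hu, hv₁, f, hfs, -, hfu, hfv⟩ := h₁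
  obtain ⟨-, hv₂, g, hgs, -, hgu, hgv⟩ := h₂
  have key : ∀ X ∈ Ω, ∀ᵐ Z ∂m, Z ∈ Metric.ball X (bdDist Ω X / 2) → v₁ Z = v₂ Z := by
    intro X hX
    have hδ := bdDist_pos hΩ hne hX
    set r := bdDist Ω X / 2 with hr
    have hr0 : 0 < r := half_pos hδ
    have h2r : Metric.ball X (2 * r) ⊆ Ω := by
      rw [hr, mul_div_cancel₀ _ two_ne_zero]
      exact ball_bdDist_subset hX
    have hcl : Metric.closedBall X r ⊆ Ω :=
      (Metric.closedBall_subset_ball (by linarith)).trans h2r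
    have hD : Metric.ball X r ⊆ Ω := Metric.ball_subset_closedBall.trans hcl
    have hle : m.restrict (Metric.ball X r) ≤ m.restrict Ω := Measure.restrict_mono hD le_rfl
    have hum : AEStronglyMeasurable u (m.restrict (Metric.ball X r)) :=
      hu.aestronglyMeasurable.mono_measure hle
    have hzero := h6.1 (Metric.ball X r) Metric.isOpen_ball
      ((isCompact_closedBall X r).of_isClosed_subset isClosed_closure
        Metric.closure_ball_subset_closedBall)
      (Metric.closure_ball_subset_closedBall.trans hcl) (fun i Z => f i Z - g i Z)
      (fun Z => v₁ Z - v₂ Z) (fun i => (hfs i).sub (hgs i))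
      ((hv₁.sub hv₂).mono_measure hle) ?_ ?_
    · filter_upwards [(ae_restrict_iff' measurableSet_ball).1 hzero] with Z hZ hZD
      exact sub_eq_zero.1 (hZ hZD)
    · have hlim := (hfu X r hr0 h2r).add (hgu X r hr0 h2r)
      rw [add_zero] at hlim
      refine tendsto_of_tendsto_of_tendsto_of_le_of_le tendsto_const_nhds hlim
        (fun _ => zero_le) fun i => ?_
      simp only
      have hgm : AEMeasurable (fun Z => ‖g i Z - u Z‖ₑ) (m.restrict (Metric.ball X r)) :=
        ((hgs i).continuous.aestronglyMeasurable.sub hum).enorm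
      rw [← lintegral_add_right' _ hgm]
      refine lintegral_mono fun Z => ?_
      have : f i Z - g i Z = (f i Z - u Z) - (g i Z - u Z) := by ring
      simp only [this]
      exact enorm_sub_le
    · have hlim := (ENNReal.Tendsto.const_mul (a := 2) hfv (Or.inr ENNReal.ofNat_ne_top)).add
        (ENNReal.Tendsto.const_mul (a := 2) hgv (Or.inr ENNReal.ofNat_ne_top))
      simp only [mul_zero, add_zero] at hlim
      refine tendsto_of_tendsto_of_tendsto_of_le_of_le tendsto_const_nhds hlim
        (fun _ => zero_le) fun i => ?_
      simp only
      have hgm : AEMeasurable (fun Z => 2 * ‖gradient (g i) Z - v₂ Z‖ₑ ^ 2) (m.restrict Ω) := by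
        have hc : Continuous (gradient (g i)) :=
          (InnerProductSpace.toDual ℝ (E n)).symm.continuous.comp
            ((hgs i).continuous_fderiv (by simp))
        exact ((hc.aestronglyMeasurable.sub hv₂.1).enorm.pow_const 2).const_mul 2
      rw [← lintegral_const_mul' _ _ ENNReal.ofNat_ne_top,
        ← lintegral_const_mul' _ _ ENNReal.ofNat_ne_top, ← lintegral_add_right' _ hgm]
      refine (lintegral_mono fun Z => ?_).trans (lintegral_mono_set hD)
      rw [gradient_sub ((hfs i).differentiable (by simp) Z) ((hgs i).differentiable (by simp) Z),
        sub_sub_sub_comm]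
      exact enorm_sub_sq_le _ _
  refine (ae_restrict_iff' hΩ.measurableSet).2 ?_
  rw [ae_iff]
  refine measure_null_of_locally_null _ fun X hX => ?_
  have hXΩ : X ∈ Ω := by
    by_contra h
    exact hX fun hX' => absurd hX' h
  refine ⟨{Z | ¬(Z ∈ Ω → v₁ Z = v₂ Z)} ∩ Metric.ball X (bdDist Ω X / 2),
    inter_mem_nhdsWithin _ (Metric.ball_mem_nhds X (half_pos (bdDist_pos hΩ hne hXΩ))), ?_⟩
  refine measure_mono_null (fun Z hZ => ?_) (ae_iff.1 (key X hXΩ))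
  exact fun hZ' => hZ.1 fun _ => hZ' hZ.2

section Congr

variable {n : ℕ} {Ω : Set (E n)} {m μ : Measure (E n)} {g g' : E n → ℝ}

lemma ext_congr_ae (φ : Dyadic n → E n → ℝ) (ξ : Dyadic n → E n) (h : g =ᵐ[μ] g') :
    ext Ω μ φ ξ g = ext Ω μ φ ξ g' := by
  ext X
  unfold ext
  congr 1
  ext I
  rw [setAverage_eq, setAverage_eq, integral_congr_ae (ae_restrict_of_ae h)]

lemma hEnergy_congr_ae (h : g =ᵐ[μ] g') : hEnergy Ω m μ g = hEnergy Ω m μ g' := by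
  refine lintegral_congr_ae ?_
  filter_upwards [h] with x hx
  refine lintegral_congr_ae ?_
  filter_upwards [h] with y hy
  rw [hx, hy]

end Congr

lemma dim_pos_of_frontier {n : ℕ} {Ω : Set (E n)} (h : ¬ Bornology.IsBounded (frontier Ω)) :
    0 < n := by
  rcases n.eq_zero_or_pos with rfl | hn
  · exact absurd (Set.toFinite (frontier Ω)).isBounded h
  · exact hn

end ExtThm

/-! ### The main theorem. -/

theorem mainTheorem5 (n : ℕ) (K C₃ C₄ C₅ : ℝ) :
    ∃ C : ℝ, 0 < C ∧
      ∀ (Ω : Set (ExtThm.E n)) (m μ : MeasureTheory.Measure (ExtThm.E n)) (C₁ C₆ : ℝ) (N : ℕ),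
        IsOpen Ω → ¬ Bornology.IsBounded (frontier Ω) →
        ExtThm.H1 Ω C₁ → ExtThm.H2 Ω C₁ N → ExtThm.H3 Ω μ C₃ → ExtThm.H4 Ω m C₄ →
        ExtThm.H5 Ω m μ C₅ → ExtThm.H6 Ω m C₆ →
        ∀ (φ : ExtThm.Dyadic n → ExtThm.E n → ℝ) (ξ : ExtThm.Dyadic n → ExtThm.E n),
          ExtThm.IsWhitneyPartition Ω K φ → ExtThm.IsWhitneyCenters Ω ξ →
          -- the trace of the extension, for any access cones
          (∀ (D : ℤ → Set (Set (ExtThm.E n))) (Ca : ℝ),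
            ExtThm.IsDyadicSystem (frontier Ω) D → 1000 * C₁ * Real.sqrt n ≤ Ca →
            ∀ g : ExtThm.E n → ℝ, MeasureTheory.LocallyIntegrable g μ →
              (∀ᵐ x ∂μ, ExtThm.HasTraceAt Ω m D Ca (ExtThm.ext Ω μ φ ξ g) x (g x)) ∧
              ExtThm.trace Ω m D Ca (ExtThm.ext Ω μ φ ξ g) =ᵐ[μ] g) ∧
          -- `H` is contained in the domain of the extension operator, which is linear
          (∀ g : ExtThm.E n → ℝ, ExtThm.MemH Ω m μ g → MeasureTheory.LocallyIntegrable g μ) ∧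
          (∀ (a b : ℝ) (g h : ExtThm.E n → ℝ),
            MeasureTheory.LocallyIntegrable g μ → MeasureTheory.LocallyIntegrable h μ →
            ∀ X, ExtThm.ext Ω μ φ ξ (fun x => a * g x + b * h x) X =
              a * ExtThm.ext Ω μ φ ξ g X + b * ExtThm.ext Ω μ φ ξ h X) ∧
          -- boundedness from `H` to `W`
          (∀ g : ExtThm.E n → ℝ, ExtThm.MemH Ω m μ g →
            ExtThm.MemW Ω m (ExtThm.ext Ω μ φ ξ g) ∧
            ∀ v : ExtThm.E n → ExtThm.E n, ExtThm.HasWGradient Ω m (ExtThm.ext Ω μ φ ξ g) v →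
              v =ᵐ[m.restrict Ω] gradient (ExtThm.ext Ω μ φ ξ g) ∧
              ∫⁻ X in Ω, ‖v X‖ₑ ^ 2 ∂m ≤ ENNReal.ofReal C * ExtThm.hEnergy Ω m μ g) := by
  -- The maximum with `1` only secures positivity.
  refine ⟨max 1 (ExtThm.gradConst n C₃ K ^ 2 * C₃ ^ 6 * ExtThm.scaleConst C₃ C₅), by positivity, ?_⟩
  intro Ω m μ C₁ C₆ N hΩ hb h1 _ h3 h4 h5 h6 φ ξ hφ hξ
  have hΓ : (frontier Ω).Nonempty := by
    by_contra h
    rw [not_nonempty_iff_eq_empty] at h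
    exact hb (h ▸ Bornology.isBounded_empty)
  have hne : Ω.Nonempty := by
    by_contra h
    rw [not_nonempty_iff_eq_empty] at h
    simp [h] at hΓ
  have := h3.1
  have := h4.isLocallyFiniteMeasure hΩ hne
  have hs : ExtThm.ExtensionSetting Ω μ C₃ K φ ξ :=
    ⟨ExtThm.dim_pos_of_frontier hb, hΩ, h3.isDoublingOn hΓ, hφ, hξ⟩
  have hloc : ∀ g : ExtThm.E n → ℝ, ExtThm.MemH Ω m μ g → LocallyIntegrable g μ := fun g hg =>
    hg.locallyIntegrable hΩ hs.doubling h4 h5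
  refine ⟨fun D Ca hD hCa g hg => ?_, hloc, fun a b g h hg hh X => hs.ext_linear a b hg hh X,
    fun g hg => ?_⟩
  · have htr := hs.ae_hasTraceAt_ext h4 hb hD h1 hCa hg
    refine ⟨htr, ?_⟩
    filter_upwards [htr] with x hx
    have := hx.1
    exact hx.2.limUnder_eq
  · have hgi := hloc g hg
    obtain ⟨hgm, hE⟩ := hg
    -- The energy estimates use Tonelli with a Borel measurable `g`. The extension and the energy
    -- depend only on the `μ`-class, so `g` is replaced by a Borel representative.
    have hae := hgm.ae_eq_mk
    rw [ExtThm.hEnergy_congr_ae hae] at hE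
    rw [ExtThm.ext_congr_ae φ ξ hae, ExtThm.hEnergy_congr_ae hae]
    have hgi' : LocallyIntegrable (hgm.mk g) μ := hgi.congr hae
    have hW := hs.hasWGradient_ext h4 h5 hgm.measurable_mk hgi' hE
    refine ⟨⟨_, hW⟩, fun v hv => ?_⟩
    have hv' := hv.ae_eq hΩ hΓ h6 hW
    refine ⟨hv', ?_⟩
    rw [lintegral_congr_ae (hv'.mono fun X hX => by simp only [hX] :
      (fun X => ‖v X‖ₑ ^ 2) =ᵐ[m.restrict Ω] fun X =>
        ‖gradient (ExtThm.ext Ω μ φ ξ (hgm.mk g)) X‖ₑ ^ 2)]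
    refine (hs.lintegral_gradient_ext_le h4 h5 hgm.measurable_mk hgi').trans ?_
    gcongr
    exact le_max_right _ _
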